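/- Let $\kappa$ be a field of characteristic $0$ (for instance $\overline{\mathbb{Q}}_\ell$). For a partition $\lambda$ let $s_\lambda(\mathbf{x})$ be the Schur function in infinitely many variables $\mathbf{x}=\{x_1,x_2,\dots\}$, let $\chi^\lambda=\det(\eta_{\lambda_i-i+j})_{i,j}$ be the irreducible character of $S_{|\lambda|}$ attached to $\lambda$ (where $\eta_k$ is the trivial character of $S_k$, zero for $k<0$, and the product of characters is induction from Young subgroups), and let $V_\lambda$ be an irreducible $\kappa[S_{|\lambda|}]$-module with character $\chi^\lambda$. Let $\omega=(d_1,\omega^1)\cdots(d_r,\omega^r)$ be a finite sequence of pairs of an integer $d_i\ge 1$ and a nonempty partition $\omega^i$, put $n=\sum_i d_i|\omega^i|$ and let $\omega^+=\sum_i d_i\cdot\omega^i$ be the partition of $n$ with parts $\omega^+_k=\sum_i d_i\,\omega^i_k$. There is a unique family of integers $(c_\omega^\mu)_{\mu}$, indexed by the partitions $\mu$ of $n$, with $c_\omega^\mu=0$ unless $\mu\unlhd\omega^+$ in the dominance order, such that $$s_{\omega^1}(\mathbf{x}^{d_1})\cdots s_{\omega^r}(\mathbf{x}^{d_r})=\sum_{\mu\unlhd\omega^+}c_\omega^\mu\,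 s_\mu(\mathbf{x}),\qquad \mathbf{x}^d:=\{x_1^d,x_2^d,\dots\}$$ (the twisted Littlewood–Richardson coefficients). Put $S:=\prod_i (S_{|\omega^i|})^{d_i}\subset S_n$ and $V_\omega:=\bigotimes_{i=1}^r V_{\omega^i}^{\otimes d_i}$, and let $\rho:S\to \mathrm{GL}(V_\omega)$ be the corresponding representation. Let $N_{S_n}(S,\rho)$ be the group of those $t$ in the normalizer of $S$ in $S_n$ for which the representation $s\mapsto\rho(t^{-1}st)$ is isomorphic to $\rho$, and $W_{S_n}(S,\rho):=N_{S_n}(S,\rho)/S$. The group $\prod_i\big((S_{|\omega^i|})^{d_i}\rtimes S_{d_i}\big)\subset N_{S_n}(S,\rho)$, where $S_{d_i}$ permutes the coordinates, acts on $V_\omega$, its action on the factor $V_{\omega^i}^{\otimes d_i}$ being $(w,s)\cdot(x_1\otimes\cdots\otimes x_{d_i})=w_1x_{s^{-1}(1)}\otimes\cdots\otimes w_{d_i}x_{s^{-1}(d_i)}$. An element $t$ of it acts on $\mathrm{Ind}_S^{S_n}(V_\omega)=\kappa[S_n]\otimes_{\kappa[S]}V_\omega$ by $t\cdot(x\otimes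 u)=xt^{-1}\otimes t\cdot u$, and on $\mathrm{Hom}_{S_n}(\mathrm{Ind}_S^{S_n}(V_\omega),V_\mu)$ by $(t\cdot f)(z)=f(t^{-1}\cdot z)$; the latter action depends only on the class of $t$ in $W_{S_n}(S,\rho)$. Let $v\in W_{S_n}(S,\rho)$ be the element which acts on each $(S_{|\omega^i|})^{d_i}$ by circular permutation of the coordinates, $(g_1,\dots,g_{d_i})\mapsto(g_2,\dots,g_{d_i},g_1)$. Then for every partition $\mu$ of $n$, $$\mathrm{Tr}\left(v\,\middle|\,\mathrm{Hom}_{S_n}\big(\mathrm{Ind}_S^{S_n}(V_\omega),V_\mu\big)\right)=c_\omega^\mu.$$ -/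

import Mathlib

open scoped TensorProduct

noncomputable section

namespace TwistedLR

/-! ### Schur functions and irreducible characters of symmetric groups -/

/-- The Schur function `s_lam` in the infinitely many variables `x_0, x_1, x_2, …`: the coefficient
of the monomial `x^m` is the number of semistandard Young tableaux of shape `lam` and weight `m`. -/
def schur (lam : YoungDiagram) : MvPowerSeries ℕ ℤ := fun m =>
  (Nat.card {T : SemistandardYoungTableau lam //
    ∀ k : ℕ, (lam.cells.filter fun c => T c.1 c.2 = k).card = m k} : ℤ)

/-- The value at `g` of the permutation character `η_{a_0} η_{a_1} ⋯ η_{a_{l-1}}`, that is, of the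
character of the symmetric group induced from the trivial character of the Young subgroup
`S_{a_0} × ⋯ × S_{a_{l-1}}`: the number of maps `f` to `{0, …, l-1}` which are fixed by `g` and whose
fibre over `j` has `a_j` elements. It vanishes if some `a_j` is negative. -/
def youngPermChar {X : Type*} [Fintype X] {l : ℕ} (a : Fin l → ℤ) (g : Equiv.Perm X) : ℤ :=
  (Nat.card {f : X → Fin l // (∀ x, f (g x) = f x) ∧
    ∀ j, (Nat.card {x : X // f x = j} : ℤ) = a j} : ℤ)

/-- The character `χ^lam = det (η_{lam_i - i + j})` of the symmetric group, where `η_k` is the trivial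
character of `S_k` (zero for `k < 0`) and characters are multiplied by inducing them from
Young subgroups. Here `lam.rowLen i` is the part `lam_{i+1}` and `lam.colLen 0` is the length. -/
def chi (lam : YoungDiagram) {X : Type*} [Fintype X] (g : Equiv.Perm X) : ℤ :=
  ∑ s : Equiv.Perm (Fin (lam.colLen 0)), (Equiv.Perm.sign s : ℤ) *
    youngPermChar (fun i => (lam.rowLen (i : ℕ) : ℤ) - ((i : ℕ) : ℤ) + ((s i : ℕ) : ℤ)) g

/-! ### Types and twisted Littlewood–Richardson coefficients -/

/-- A type `ω = (d_1, ω^1) ⋯ (d_r, ω^r)`: a sequence of pairs of a positive integer and a nonempty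
partition. -/
structure PType where
  r : ℕ
  deg : Fin r → ℕ
  part : Fin r → YoungDiagram
  deg_ne : ∀ i, deg i ≠ 0
  part_ne : ∀ i, part i ≠ ⊥

namespace PType

variable (ω : PType)

/-- The product `s_ω(x) = s_{ω^1}(x^{d_1}) ⋯ s_{ω^r}(x^{d_r})`. -/
def schurProd : MvPowerSeries ℕ ℤ :=
  ∏ i, MvPowerSeries.expand (ω.deg i) (ω.deg_ne i) (schur (ω.part i))

/-- The size `∑ d_i |ω^i|`. -/
def size : ℕ := ∑ i, ω.deg i * (ω.part i).card

/-- `μ ⊴ ω⁺` in the dominance order, where `ω⁺ = ∑ d_i · ω^i` is the partition with parts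
`ω⁺_k = ∑ d_i ω^i_k`; this includes `|μ| = |ω⁺| = ∑ d_i |ω^i|`. -/
def DominatedByPlus (mu : YoungDiagram) : Prop :=
  mu.card = ω.size ∧ ∀ k : ℕ, ∑ j ∈ Finset.range k, mu.rowLen j ≤
    ∑ j ∈ Finset.range k, ∑ i, ω.deg i * (ω.part i).rowLen j

/-- `c` is the family of twisted Littlewood–Richardson coefficients of `ω`:
`s_ω(x) = ∑_{μ ⊴ ω⁺} c_ω^μ s_μ(x)`, and `c_ω^μ = 0` for the other partitions `μ`. -/
def IsTwistedLR (c : YoungDiagram →₀ ℤ) : Prop :=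
  (∀ mu, c mu ≠ 0 → ω.DominatedByPlus mu) ∧
    ω.schurProd = c.sum fun mu a => a • schur mu

/-! ### The group `S`, its normalizer, and the representation `V_ω` -/

/-- The blocks: `d_i` copies for each `i`. -/
abbrev Block := Σ i : Fin ω.r, Fin (ω.deg i)

/-- The points permuted by `S`: each of the `d_i` blocks with index `i` has `|ω^i|` points. -/
abbrev Point := Σ b : ω.Block, Fin (ω.part b.1).card

/-- The abstract product `∏ (S_{|ω^i|})^{d_i}`. -/
abbrev Base := (b : ω.Block) → Equiv.Perm (Fin (ω.part b.1).card)

/-- The group `∏ S_{d_i}` permuting the blocks with the same index. -/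
abbrev Top := (i : Fin ω.r) → Equiv.Perm (Fin (ω.deg i))

variable {ω}

/-- The action of `∏ S_{d_i}` on the blocks. -/
def blockPerm (p : ω.Top) : Equiv.Perm ω.Block where
  toFun b := ⟨b.1, p b.1 b.2⟩
  invFun b := ⟨b.1, (p b.1).symm b.2⟩
  left_inv b := by simp
  right_inv b := by simp

variable (ω)

theorem point_congr {i : Fin ω.r} {k k' : Fin (ω.deg i)} (h : k = k')
    (y : Fin (ω.part i).card) : (⟨⟨i, k⟩, y⟩ : ω.Point) = ⟨⟨i, k'⟩, y⟩ := by
  subst h; rfl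

theorem base_congr (w : ω.Base) {i : Fin ω.r} {k k' : Fin (ω.deg i)} (h : k = k') :
    (w ⟨i, k⟩ : Equiv.Perm (Fin (ω.part i).card)) = w ⟨i, k'⟩ := by
  subst h; rfl

/-- The action of `∏ S_{d_i}` on the points. -/
def topPointHom : ω.Top →* Equiv.Perm ω.Point where
  toFun p :=
    { toFun := fun x => ⟨⟨x.1.1, p x.1.1 x.1.2⟩, x.2⟩
      invFun := fun x => ⟨⟨x.1.1, (p x.1.1).symm x.1.2⟩, x.2⟩
      left_inv := fun ⟨⟨i, k⟩, y⟩ => point_congr ω ((p i).symm_apply_apply k) y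
      right_inv := fun ⟨⟨i, k⟩, y⟩ => point_congr ω ((p i).apply_symm_apply k) y }
  map_one' := rfl
  map_mul' _ _ := rfl

/-- `∏ S_{d_i}` acts on `∏ (S_{|ω^i|})^{d_i}` by permutation of the coordinates. -/
def topAut : ω.Top →* MulAut ω.Base where
  toFun p :=
    { toFun := fun w b => w ⟨b.1, (p b.1).symm b.2⟩
      invFun := fun w b => w ⟨b.1, p b.1 b.2⟩
      left_inv := fun w => by
        funext ⟨i, k⟩
        exact base_congr ω w ((p i).symm_apply_apply k)
      right_inv := fun w => by
        funext ⟨i, k⟩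
        exact base_congr ω w ((p i).apply_symm_apply k)
      map_mul' := fun _ _ => rfl }
  map_one' := rfl
  map_mul' _ _ := rfl

/-- The semidirect product `∏ ((S_{|ω^i|})^{d_i} ⋊ S_{d_i})`. -/
abbrev Ext := ω.Base ⋊[ω.topAut] ω.Top

theorem base_top_points (p : ω.Top) :
    (Equiv.Perm.sigmaCongrRightHom fun b : ω.Block => Fin (ω.part b.1).card).comp
        (ω.topAut p).toMonoidHom =
      (MulAut.conj (ω.topPointHom p)).toMonoidHom.comp
        (Equiv.Perm.sigmaCongrRightHom fun b : ω.Block => Fin (ω.part b.1).card) := by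
  ext1 w
  refine Equiv.ext fun x => ?_
  obtain ⟨⟨i, k⟩, y⟩ := x
  change (⟨⟨i, k⟩, w ⟨i, (p i).symm k⟩ y⟩ : ω.Point) =
    ⟨⟨i, p i ((p i).symm k)⟩, w ⟨i, (p i).symm k⟩ y⟩
  exact ω.point_congr ((p i).apply_symm_apply k).symm _

section Embedded

variable {n : ℕ} (e : ω.Point ≃ Fin n)

/-- The embedding of `∏ (S_{|ω^i|})^{d_i}` into `S_n`, the points being numbered by `e`. -/
def baseHom : ω.Base →* Equiv.Perm (Fin n) :=
  e.permCongrHom.toMonoidHom.comp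
    (Equiv.Perm.sigmaCongrRightHom fun b : ω.Block => Fin (ω.part b.1).card)

theorem baseHom_injective : Function.Injective (ω.baseHom e) :=
  e.permCongrHom.injective.comp Equiv.Perm.sigmaCongrRightHom_injective

/-- The map `∏ ((S_{|ω^i|})^{d_i} ⋊ S_{d_i}) → S_n`. -/
def extHom : ω.Ext →* Equiv.Perm (Fin n) :=
  SemidirectProduct.lift (ω.baseHom e) (e.permCongrHom.toMonoidHom.comp ω.topPointHom) fun p => by
    ext1 w
    have h := congrArg e.permCongrHom (DFunLike.congr_fun (ω.base_top_points p) w)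
    simpa only [baseHom, MulAut.conj_apply, MonoidHom.comp_apply, MulEquiv.coe_toMonoidHom,
      map_mul, map_inv] using h

/-- The subgroup `S` of `S_n`. -/
def subgroupS : Subgroup (Equiv.Perm (Fin n)) := (ω.baseHom e).range

/-- `S` as the product `∏ (S_{|ω^i|})^{d_i}`. -/
def baseEquiv : ω.Base ≃* ω.subgroupS e :=
  MonoidHom.ofInjective (ω.baseHom_injective e)

end Embedded

section Rep

variable {κ : Type*} [Field κ] {V : YoungDiagram → Type*} [∀ lam, AddCommGroup (V lam)]
  [∀ lam, Module κ (V lam)]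
  (ρ : ∀ lam : YoungDiagram, Representation κ (Equiv.Perm (Fin lam.card)) (V lam))

/-- The space `V_ω = ⨂ T^{d_i} V_{ω^i}`. -/
abbrev VSpace (κ : Type*) [Field κ] (V : YoungDiagram → Type*) [∀ lam, AddCommGroup (V lam)]
    [∀ lam, Module κ (V lam)] : Type _ :=
  ⨂[κ] b : ω.Block, V (ω.part b.1)

/-- The outer tensor product representation of `∏ (S_{|ω^i|})^{d_i}` on `V_ω`. -/
def baseRep : Representation κ ω.Base (ω.VSpace κ V) :=
  PiTensorProduct.mapMonoidHom.comp
    (MonoidHom.pi fun b : ω.Block => (ρ (ω.part b.1)).comp (Pi.evalMonoidHom _ b))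

variable (κ V) in
/-- `∏ S_{d_i}` acts on `V_ω` by permuting the tensor factors. -/
def topOp (p : ω.Top) : ω.VSpace κ V →ₗ[κ] ω.VSpace κ V :=
  (PiTensorProduct.reindex κ (fun b : ω.Block => V (ω.part b.1)) (blockPerm p)).toLinearMap

theorem topOp_tprod (p : ω.Top) (x : ∀ b : ω.Block, V (ω.part b.1)) :
    ω.topOp κ V p (PiTensorProduct.tprod κ x) =
      PiTensorProduct.tprod κ fun b : ω.Block => x ⟨b.1, (p b.1).symm b.2⟩ :=
  PiTensorProduct.reindex_tprod (blockPerm p) x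

theorem baseRep_tprod (w : ω.Base) (x : ∀ b : ω.Block, V (ω.part b.1)) :
    ω.baseRep ρ w (PiTensorProduct.tprod κ x) =
      PiTensorProduct.tprod κ fun b => ρ (ω.part b.1) (w b) (x b) :=
  PiTensorProduct.map_tprod _ x

variable (κ V) in
/-- `topOp` as a representation of `∏ S_{d_i}`. -/
def topRep : Representation κ ω.Top (ω.VSpace κ V) where
  toFun := ω.topOp κ V
  map_one' := by
    refine PiTensorProduct.ext (MultilinearMap.ext fun x => ?_)
    exact ω.topOp_tprod 1 x
  map_mul' p q := by
    refine PiTensorProduct.ext (MultilinearMap.ext fun x => ?_)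
    change ω.topOp κ V (p * q) (PiTensorProduct.tprod κ x) =
      ω.topOp κ V p (ω.topOp κ V q (PiTensorProduct.tprod κ x))
    rw [topOp_tprod, topOp_tprod, topOp_tprod]
    rfl

theorem topRep_baseRep (p : ω.Top) (w : ω.Base) :
    ω.topRep κ V p * ω.baseRep ρ w = ω.baseRep ρ (ω.topAut p w) * ω.topRep κ V p := by
  refine PiTensorProduct.ext (MultilinearMap.ext fun x => ?_)
  change ω.topOp κ V p (ω.baseRep ρ w (PiTensorProduct.tprod κ x)) =
    ω.baseRep ρ (ω.topAut p w) (ω.topOp κ V p (PiTensorProduct.tprod κ x))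
  rw [topOp_tprod, baseRep_tprod, topOp_tprod, baseRep_tprod]
  rfl

/-- The action of `∏ ((S_{|ω^i|})^{d_i} ⋊ S_{d_i})` on `V_ω`:
`(w, s) · ⨂ x_b = ⨂ w_b · x_{s⁻¹ b}`. -/
def extRep : Representation κ ω.Ext (ω.VSpace κ V) where
  toFun g := ω.baseRep ρ g.left * ω.topRep κ V g.right
  map_one' := by simp
  map_mul' g h := by
    simp only [SemidirectProduct.mul_left, SemidirectProduct.mul_right, map_mul]
    rw [mul_assoc, mul_assoc, ← mul_assoc (ω.topRep κ V g.right), topRep_baseRep]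
    simp only [mul_assoc]

variable {n : ℕ} (e : ω.Point ≃ Fin n)

/-- The representation `ρ : S → GL(V_ω)`. -/
def repS : Representation κ (ω.subgroupS e) (ω.VSpace κ V) :=
  (ω.baseRep ρ).comp (ω.baseEquiv e).symm.toMonoidHom

end Rep

end PType

/-! ### The groups `N_K(H, ρ)` and `W_K(H, ρ)` -/

section Stabilizer

variable {κ K A : Type*} [Field κ] [Group K] [AddCommGroup A] [Module κ A]
  (H : Subgroup K) (σ : Representation κ H A)

/-- For `t` in the normalizer of `H`, the representation `t^*(σ) = σ ∘ t⁻¹ : h ↦ σ (t⁻¹ h t)`. -/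
def twist (t : Subgroup.normalizer (H : Set K)) : Representation κ H A :=
  σ.comp (H.normalizerMonoidHom t)⁻¹.toMonoidHom

theorem twist_apply (t : Subgroup.normalizer (H : Set K)) (h : H) :
    twist H σ t h = σ ((H.normalizerMonoidHom t)⁻¹ h) := rfl

theorem twist_mul (s t : Subgroup.normalizer (H : Set K)) :
    twist H σ (s * t) = twist H (twist H σ t) s := by
  ext1 h
  simp only [twist_apply, map_mul, mul_inv_rev, MulAut.mul_apply]

theorem twist_one : twist H σ 1 = σ := by
  ext1 h
  simp only [twist_apply, map_one, inv_one, MulAut.one_apply]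

/-- An isomorphism stays an isomorphism after twisting. -/
def twistEquiv {σ τ : Representation κ H A} (f : σ.Equiv τ)
    (t : Subgroup.normalizer (H : Set K)) : (twist H σ t).Equiv (twist H τ t) :=
  Representation.Equiv.mk f.toLinearEquiv fun _ => f.isIntertwining' _

/-- `N_K(H, σ)`: the elements `t` of the normalizer of `H` in `K` with `t^*(σ) ≃ σ`. -/
def stabN : Subgroup (Subgroup.normalizer (H : Set K)) where
  carrier := {t | Nonempty ((twist H σ t).Equiv σ)}
  one_mem' := by
    rw [Set.mem_ofPred_eq, twist_one]
    exact ⟨Representation.Equiv.refl σ⟩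
  mul_mem' := by
    rintro s t ⟨f⟩ ⟨g⟩
    rw [Set.mem_ofPred_eq, twist_mul]
    exact ⟨(twistEquiv H g s).trans f⟩
  inv_mem' := by
    rintro s ⟨f⟩
    have h := twistEquiv H f s⁻¹
    rw [← twist_mul, inv_mul_cancel, twist_one] at h
    exact ⟨h.symm⟩

/-- `W_K(H, σ) = N_K(H, σ) / H`. -/
abbrev stabW : Type _ :=
  stabN H σ ⧸ (H.subgroupOf (Subgroup.normalizer (H : Set K))).subgroupOf (stabN H σ)

end Stabilizer

namespace PType

variable (ω : PType) {κ : Type*} [Field κ] {V : YoungDiagram → Type*}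
  [∀ lam, AddCommGroup (V lam)] [∀ lam, Module κ (V lam)]
  (ρ : ∀ lam : YoungDiagram, Representation κ (Equiv.Perm (Fin lam.card)) (V lam))
  {n : ℕ} (e : ω.Point ≃ Fin n)

/-- Conjugation by `g ∈ S ⋊ ∏ S_{d_i}` on the first factor. -/
def extConj (g : ω.Ext) : MulAut ω.Base := MulAut.conj g.left * ω.topAut g.right

theorem extHom_conj (g : ω.Ext) (w : ω.Base) :
    ω.extHom e g * ω.baseHom e w * (ω.extHom e g)⁻¹ = ω.baseHom e (ω.extConj g w) := by
  have h1 : ∀ u : ω.Base, ω.baseHom e u = ω.extHom e (SemidirectProduct.inl u) := fun u => by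
    simp [extHom]
  rw [h1, h1, ← map_inv, ← map_mul, ← map_mul]
  congr 1
  ext1 <;> simp [extConj, mul_assoc]

theorem extRep_baseRep (g : ω.Ext) (w : ω.Base) :
    ω.extRep ρ g * ω.baseRep ρ w = ω.baseRep ρ (ω.extConj g w) * ω.extRep ρ g := by
  change ω.baseRep ρ g.left * ω.topRep κ V g.right * ω.baseRep ρ w =
    ω.baseRep ρ (ω.extConj g w) * (ω.baseRep ρ g.left * ω.topRep κ V g.right)
  rw [mul_assoc, topRep_baseRep, ← mul_assoc, ← mul_assoc, ← map_mul, ← map_mul]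
  simp [extConj]

theorem extHom_mem_normalizer (g : ω.Ext) :
    ω.extHom e g ∈ Subgroup.normalizer (ω.subgroupS e : Set (Equiv.Perm (Fin n))) := by
  rw [Subgroup.mem_normalizer_iff]
  intro h
  constructor
  · rintro ⟨w, rfl⟩
    exact ⟨_, (ω.extHom_conj e g w).symm⟩
  · rintro ⟨w, hw⟩
    refine ⟨ω.extConj g⁻¹ w, ?_⟩
    rw [← extHom_conj, hw, map_inv]
    group

/-- The map `S ⋊ ∏ S_{d_i} → N_{S_n}(S)`. -/
def extToNormalizer :
    ω.Ext →* Subgroup.normalizer (ω.subgroupS e : Set (Equiv.Perm (Fin n))) :=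
  (ω.extHom e).codRestrict _ (ω.extHom_mem_normalizer e)

theorem extRep_repS (g : ω.Ext) (s : ω.subgroupS e) :
    ω.extRep ρ g * ω.repS ρ e s =
      ω.repS ρ e ((ω.subgroupS e).normalizerMonoidHom (ω.extToNormalizer e g) s) *
        ω.extRep ρ g := by
  obtain ⟨w, rfl⟩ := (ω.baseEquiv e).surjective s
  have h : (ω.subgroupS e).normalizerMonoidHom (ω.extToNormalizer e g) (ω.baseEquiv e w) =
      ω.baseEquiv e (ω.extConj g w) := by
    apply Subtype.ext
    exact ω.extHom_conj e g w
  rw [h]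
  simpa [repS] using ω.extRep_baseRep ρ g w

theorem extToNormalizer_mem (g : ω.Ext) :
    ω.extToNormalizer e g ∈ stabN (ω.subgroupS e) (ω.repS ρ e) := by
  refine ⟨Representation.Equiv.mk (LinearEquiv.ofLinearMap (ω.extRep ρ g) (ω.extRep ρ g⁻¹)
    ?_ ?_) ?_⟩
  · change ω.extRep ρ g * ω.extRep ρ g⁻¹ = 1
    rw [← map_mul, mul_inv_cancel, map_one]
  · change ω.extRep ρ g⁻¹ * ω.extRep ρ g = 1
    rw [← map_mul, inv_mul_cancel, map_one]
  · intro s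
    have h := ω.extRep_repS ρ e g
      (((ω.subgroupS e).normalizerMonoidHom (ω.extToNormalizer e g))⁻¹ s)
    rw [MulAut.apply_inv_self] at h
    exact h

/-- The map `S ⋊ ∏ S_{d_i} → N_{S_n}(S, ρ)`. -/
def extToN : ω.Ext →* stabN (ω.subgroupS e) (ω.repS ρ e) :=
  (ω.extToNormalizer e).codRestrict _ (ω.extToNormalizer_mem ρ e)

/-- The element of `∏ S_{d_i}` which acts on `(S_{|ω^i|})^{d_i}` by circular permutation of the
coordinates, `(g_1, …, g_d) ↦ (g_2, …, g_d, g_1)`, for all `i`. -/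
def circ : ω.Top := fun i => (finRotate (ω.deg i))⁻¹

/-- The element `v` of `W_{S_n}(S, ρ)`, circular permutation on each `(S_{|ω^i|})^{d_i}`. -/
def v : stabW (ω.subgroupS e) (ω.repS ρ e) :=
  QuotientGroup.mk (ω.extToN ρ e (SemidirectProduct.inr ω.circ))

/-! ### The action on `Hom_{S_n}(Ind_S^{S_n} V_ω, W)` -/

/-- The induced representation `Ind_S^{S_n}(V_ω)`. In Mathlib it is the space of `S`-coinvariants
`(κ[S_n] ⊗ V_ω)_S`, in which `x ⊗ u` stands for `x⁻¹ ⊗ u` of `κ[S_n] ⊗_{κ[S]} V_ω`. -/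
abbrev indRep : Representation κ (Equiv.Perm (Fin n))
    (Representation.IndV (ω.subgroupS e).subtype (ω.repS ρ e)) :=
  Representation.ind (ω.subgroupS e).subtype (ω.repS ρ e)

/-- The operator `y ⊗ u ↦ t y ⊗ t · u` on `κ[S_n] ⊗ V_ω`. -/
def extTensor (t : ω.Ext) :
    Module.End κ (MonoidAlgebra κ (Equiv.Perm (Fin n)) ⊗[κ] ω.VSpace κ V) :=
  TensorProduct.map (Representation.leftRegular κ (Equiv.Perm (Fin n)) (ω.extHom e t))
    (ω.extRep ρ t)

theorem extTensor_mul (t t' : ω.Ext) :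
    ω.extTensor ρ e (t * t') = ω.extTensor ρ e t * ω.extTensor ρ e t' := by
  simp only [extTensor, map_mul, TensorProduct.map_mul]

theorem extTensor_one : ω.extTensor (V := V) ρ e 1 = 1 := by
  simp only [extTensor, map_one, TensorProduct.map_one]

theorem extTensor_comm (t : ω.Ext) (s : ω.subgroupS e) :
    ω.extTensor ρ e t *
        Representation.tprod ((Representation.leftRegular κ (Equiv.Perm (Fin n))).comp
          (ω.subgroupS e).subtype) (ω.repS ρ e) s =
      Representation.tprod ((Representation.leftRegular κ (Equiv.Perm (Fin n))).comp
          (ω.subgroupS e).subtype) (ω.repS ρ e)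
          ((ω.subgroupS e).normalizerMonoidHom (ω.extToNormalizer e t) s) *
        ω.extTensor ρ e t := by
  have h1 : (((ω.subgroupS e).normalizerMonoidHom (ω.extToNormalizer e t) s : ω.subgroupS e) :
      Equiv.Perm (Fin n)) = ω.extHom e t * s * (ω.extHom e t)⁻¹ := rfl
  simp only [extTensor, Representation.tprod_apply, ← TensorProduct.map_mul, extRep_repS,
    MonoidHom.comp_apply, Subgroup.subtype_apply, h1, ← map_mul, inv_mul_cancel_right]

/-- The action of `t ∈ S ⋊ ∏ S_{d_i}` on `Ind_S^{S_n}(V_ω)`; it is `x ⊗ u ↦ x t⁻¹ ⊗ t · u` on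
`κ[S_n] ⊗_{κ[S]} V_ω`, that is, `y ⊗ u ↦ t y ⊗ t · u` on the coinvariants (with `y = x⁻¹`). -/
def extInd (t : ω.Ext) :
    Module.End κ (Representation.IndV (ω.subgroupS e).subtype (ω.repS ρ e)) :=
  Representation.Coinvariants.lift _
    (Representation.Coinvariants.mk _ ∘ₗ ω.extTensor ρ e t) fun s => by
      refine LinearMap.ext fun x => ?_
      have h := LinearMap.congr_fun (ω.extTensor_comm ρ e t s) x
      simp only [Module.End.mul_apply] at h
      simp only [LinearMap.comp_apply, h, Representation.Coinvariants.mk_self_apply]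

theorem extInd_mul (t t' : ω.Ext) :
    ω.extInd ρ e (t * t') = ω.extInd ρ e t * ω.extInd ρ e t' := by
  refine Representation.Coinvariants.hom_ext (LinearMap.ext fun x => ?_)
  exact congrArg (Representation.Coinvariants.mk _)
    (LinearMap.congr_fun (ω.extTensor_mul ρ e t t') x)

theorem extInd_one : ω.extInd (V := V) ρ e 1 = 1 := by
  refine Representation.Coinvariants.hom_ext (LinearMap.ext fun x => ?_)
  exact congrArg (Representation.Coinvariants.mk _)
    (LinearMap.congr_fun (ω.extTensor_one ρ e) x)

theorem extInd_mk (t : ω.Ext) (y : Equiv.Perm (Fin n)) (u : ω.VSpace κ V) :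
    ω.extInd ρ e t (Representation.IndV.mk (ω.subgroupS e).subtype (ω.repS ρ e) y u) =
      Representation.IndV.mk (ω.subgroupS e).subtype (ω.repS ρ e) (ω.extHom e t * y)
        (ω.extRep ρ t u) := by
  simp [extInd, extTensor]

/-- The action on `Ind_S^{S_n}(V_ω)` commutes with `S_n`. -/
def extIndMap (t : ω.Ext) :
    Representation.IntertwiningMap (ω.indRep ρ e) (ω.indRep ρ e) where
  toLinearMap := ω.extInd ρ e t
  isIntertwining' g := by
    refine Representation.IndV.hom_ext _ _ fun h => LinearMap.ext fun x => ?_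
    change ω.extInd ρ e t (ω.indRep ρ e g (Representation.IndV.mk _ _ h x)) =
      ω.indRep ρ e g (ω.extInd ρ e t (Representation.IndV.mk _ _ h x))
    rw [Representation.ind_mk, extInd_mk, extInd_mk, Representation.ind_mk, mul_assoc]

variable {M : Type*} [AddCommGroup M] [Module κ M]
  (τ : Representation κ (Equiv.Perm (Fin n)) M)

/-- The action of `S ⋊ ∏ S_{d_i}` on `Hom_{S_n}(Ind_S^{S_n}(V_ω), M)`:
`(t · f)(z) = f (t⁻¹ · z)`. -/
def homRep : Representation κ ω.Ext (Representation.IntertwiningMap (ω.indRep ρ e) τ) where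
  toFun t :=
    { toFun := fun f => f.comp (ω.extIndMap ρ e t⁻¹)
      map_add' := fun _ _ => rfl
      map_smul' := fun _ _ => rfl }
  map_one' := by
    refine LinearMap.ext fun f => Representation.IntertwiningMap.ext (LinearMap.ext fun z => ?_)
    change f (ω.extInd ρ e 1⁻¹ z) = f z
    rw [inv_one, extInd_one]
    rfl
  map_mul' t t' := by
    refine LinearMap.ext fun f => Representation.IntertwiningMap.ext (LinearMap.ext fun z => ?_)
    change f (ω.extInd ρ e (t * t')⁻¹ z) = f (ω.extInd ρ e t'⁻¹ (ω.extInd ρ e t⁻¹ z))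
    rw [mul_inv_rev, extInd_mul]
    rfl

end PType

end TwistedLR

end

/-! After multiplication by `|S| = ∏ |ω^i|!^{d_i}`, both sides become the same sum over `w ∈ S`,
with terms `∏_i χ^{ω^i}(w_{i,1} ⋯ w_{i,d_i}) · χ^μ(w v)`. Here `v` is lifted to the permutation of
the points that rotates the blocks.

Trace side. By Frobenius reciprocity, `Hom_{S_n}(Ind V_ω, V_μ)` is the space of `S`-invariants in
`Hom_κ(V_ω, V_μ)`. The trace of `v` there is the average over `S` of the traces on the whole space
(`trace_eq_average`, `trace_homRep`). Each of these is a character value on `V_μ` times a trace on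
the dual of `V_ω`. A rotation of tensor factors combined with operators on the factors has as trace
the trace of the product of the operators, because both are sums over closed walks
(`trace_extRep_inv`).

Symmetric function side. The Frobenius formula `factorial_smul_schur` writes each `s_{ω^i}` as a
combination of power sums. A map fixed by `w v` is determined on the blocks of index `i` by one map
fixed by `w_{i,1} ⋯ w_{i,d_i}`, repeated with the same content `d_i` times. So the power sum of `w
v` is the product of the power sums of these products, taken in the variables `x^{d_i}`
(`fixSeries_circPerm`). Hence `|S| s_ω` is a combination of power sums of the elements `w v`
(`card_base_smul_schurProd`), and extracting the coefficient of `s_μ` turns each power sum into a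
value of `χ^μ` (`chi_eq_schurCoord`).

The link between tableaux and the determinantal characters is the Jacobi–Trudi identity, proved by
induction on the number of variables (`schurPoly_eq_det`); an orbit count then gives the Frobenius
formula. The functionals `schurCoord` are dual to the Schur functions: their matrix is unitriangular
for dominance, and symmetric by the Frobenius formula, hence the identity. An induction on the sum
of squares of the exponents shows that they detect every homogeneous symmetric function, so that the
coefficients exist. -/

noncomputable section
namespace TwistedLR

/-! ### Generating series of weighted types -/

section WeightSeries

variable {σ A B : Type*}

/-- The generating series of a type `A` with a weight function: the coefficient of `x^m` is the
number of elements of weight `m`. -/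
def weightSeries (wt : A → σ →₀ ℕ) : MvPowerSeries σ ℤ := fun m => (Nat.card {a // wt a = m} : ℤ)

/-- There are finitely many elements of each weight. -/
def FiniteFibres (wt : A → σ →₀ ℕ) : Prop := ∀ m, Finite {a // wt a = m}

theorem coeff_weightSeries (wt : A → σ →₀ ℕ) (m : σ →₀ ℕ) :
    MvPowerSeries.coeff m (weightSeries wt) = (Nat.card {a // wt a = m} : ℤ) := rfl

theorem weightSeries_congr {wt : A → σ →₀ ℕ} {wt' : B → σ →₀ ℕ} (e : A ≃ B)
    (h : ∀ a, wt' (e a) = wt a) : weightSeries wt = weightSeries wt' := by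
  ext m
  rw [coeff_weightSeries, coeff_weightSeries]
  exact congrArg _ (Nat.card_congr (e.subtypeEquiv fun a => by rw [h]))

theorem FiniteFibres.congr {wt : A → σ →₀ ℕ} {wt' : B → σ →₀ ℕ} (hw : FiniteFibres wt)
    (e : A ≃ B) (h : ∀ a, wt' (e a) = wt a) : FiniteFibres wt' := fun m =>
  have := hw m
  Finite.of_equiv _ (e.subtypeEquiv (p := fun a => wt a = m) fun a => by rw [h])

/-- Pairs of total weight `m`, sorted by the weights of the components. -/
def pairFibreEquiv [DecidableEq σ] (wt : A → σ →₀ ℕ) (wt' : B → σ →₀ ℕ) (m : σ →₀ ℕ) :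
    {p : A × B // wt p.1 + wt' p.2 = m} ≃
      Σ q : Finset.HasAntidiagonal.antidiagonal m, {a // wt a = q.1.1} × {b // wt' b = q.1.2} where
  toFun p := ⟨⟨(wt p.1.1, wt' p.1.2), Finset.HasAntidiagonal.mem_antidiagonal.2 p.2⟩, ⟨p.1.1, rfl⟩, ⟨p.1.2, rfl⟩⟩
  invFun q := ⟨(q.2.1.1, q.2.2.1), by
    rw [q.2.1.2, q.2.2.2]; exact Finset.HasAntidiagonal.mem_antidiagonal.1 q.1.2⟩
  left_inv _ := rfl
  right_inv := by
    rintro ⟨⟨⟨p, q⟩, h⟩, ⟨a, ha⟩, ⟨b, hb⟩⟩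
    change wt a = p at ha
    change wt' b = q at hb
    subst ha hb
    rfl

/-- Sorting pairs by how the total weight splits is the Cauchy product. Finiteness matters because
`Nat.card` assigns 0 to an infinite fibre. -/
theorem weightSeries_mul {wt : A → σ →₀ ℕ} {wt' : B → σ →₀ ℕ} (h : FiniteFibres wt)
    (h' : FiniteFibres wt') :
    weightSeries wt * weightSeries wt' = weightSeries fun p : A × B => wt p.1 + wt' p.2 := by
  classical
  ext m
  rw [MvPowerSeries.coeff_mul, coeff_weightSeries, Nat.card_congr (pairFibreEquiv wt wt' m)]
  have (q : Finset.HasAntidiagonal.antidiagonal m) : Finite ({a // wt a = q.1.1} × {b // wt' b = q.1.2}) :=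
    have := h q.1.1
    have := h' q.1.2
    inferInstance
  rw [Nat.card_sigma]
  simp only [coeff_weightSeries, Nat.card_prod, Nat.cast_sum, Nat.cast_mul]
  rw [← Finset.sum_coe_sort]

theorem FiniteFibres.prod {wt : A → σ →₀ ℕ} {wt' : B → σ →₀ ℕ} (h : FiniteFibres wt)
    (h' : FiniteFibres wt') : FiniteFibres fun p : A × B => wt p.1 + wt' p.2 := by
  classical
  intro m
  have (q : Finset.HasAntidiagonal.antidiagonal m) : Finite ({a // wt a = q.1.1} × {b // wt' b = q.1.2}) :=
    have := h q.1.1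
    have := h' q.1.2
    inferInstance
  exact Finite.of_equiv _ (pairFibreEquiv wt wt' m).symm

/-- The two claims are proved together: the inductive step for the product needs finite fibres for
the tail. -/
theorem weightSeries_pi_aux {r : ℕ} {A : Fin r → Type*} (wt : ∀ i, A i → σ →₀ ℕ)
    (h : ∀ i, FiniteFibres (wt i)) :
    (∏ i, weightSeries (wt i) = weightSeries fun a : ∀ i, A i => ∑ i, wt i (a i)) ∧
      FiniteFibres fun a : ∀ i, A i => ∑ i, wt i (a i) := by
  classical
  induction r with
  | zero =>
    constructor
    · ext m
      rw [coeff_weightSeries, Finset.prod_of_isEmpty, MvPowerSeries.coeff_one]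
      split_ifs with hm
      · subst hm
        have : Unique {a : ∀ i, A i // ∑ i, wt i (a i) = 0} :=
          ⟨⟨⟨fun i => i.elim0, by simp⟩⟩, fun a => Subtype.ext (funext fun i => i.elim0)⟩
        simp
      · have : IsEmpty {a : ∀ i, A i // ∑ i, wt i (a i) = m} :=
          ⟨fun a => hm (by rw [← a.2]; simp)⟩
        rw [Nat.card_of_isEmpty, Nat.cast_zero]
    · intro m
      infer_instance
  | succ r ih =>
    obtain ⟨ih1, ih2⟩ := ih (fun i => wt i.succ) fun i => h i.succ
    have hc (p : A 0 × ∀ i : Fin r, A i.succ) :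
        ∑ i, wt i (Fin.consEquiv A p i) = wt 0 p.1 + ∑ i : Fin r, wt i.succ (p.2 i) := by
      rw [Fin.sum_univ_succ]
      rfl
    constructor
    · rw [Fin.prod_univ_succ, ih1, weightSeries_mul (h 0) ih2]
      exact weightSeries_congr (Fin.consEquiv A) hc
    · exact ((h 0).prod ih2).congr (Fin.consEquiv A) hc

theorem prod_weightSeries {r : ℕ} {A : Fin r → Type*} (wt : ∀ i, A i → σ →₀ ℕ)
    (h : ∀ i, FiniteFibres (wt i)) :
    ∏ i, weightSeries (wt i) = weightSeries fun a : ∀ i, A i => ∑ i, wt i (a i) :=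
  (weightSeries_pi_aux wt h).1

theorem X_pow_mul_weightSeries {wt : A → σ →₀ ℕ} (h : FiniteFibres wt) (s : σ) (p : ℕ) :
    MvPowerSeries.X s ^ p * weightSeries wt =
      weightSeries fun a => Finsupp.single s p + wt a := by
  classical
  have h1 : (MvPowerSeries.X s ^ p : MvPowerSeries σ ℤ) =
      weightSeries fun _ : Unit => Finsupp.single s p := by
    ext m
    rw [MvPowerSeries.coeff_X_pow, coeff_weightSeries]
    split_ifs with hm
    · subst hm
      simp
    · have : IsEmpty {_a : Unit // Finsupp.single s p = m} := ⟨fun a => hm a.2.symm⟩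
      simp
  rw [h1, weightSeries_mul (fun m => inferInstance) h]
  exact weightSeries_congr (Equiv.punitProd A) fun _ => rfl

theorem weightSeries_sigma {ι : Type*} [Fintype ι] {A : ι → Type*} (wt : ∀ i, A i → σ →₀ ℕ)
    (h : ∀ i, FiniteFibres (wt i)) :
    weightSeries (fun a : Σ i, A i => wt a.1 a.2) = ∑ i, weightSeries (wt i) := by
  ext m
  let e : {a : Σ i, A i // wt a.1 a.2 = m} ≃ Σ i, {a : A i // wt i a = m} :=
    { toFun := fun a => ⟨a.1.1, a.1.2, a.2⟩
      invFun := fun a => ⟨⟨a.1, a.2.1⟩, a.2.2⟩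
      left_inv := fun _ => rfl
      right_inv := fun _ => rfl }
  have := fun i => h i m
  rw [coeff_weightSeries, Nat.card_congr e, Nat.card_sigma, map_sum]
  simp only [coeff_weightSeries, Nat.cast_sum]

theorem FiniteFibres.smul {wt : A → σ →₀ ℕ} (h : FiniteFibres wt) {d : ℕ} (hd : d ≠ 0) :
    FiniteFibres fun a => d • wt a := by
  intro m
  by_cases hm : ∃ m', m = d • m'
  · obtain ⟨m', rfl⟩ := hm
    have := h m'
    refine Finite.of_injective (fun a => ⟨a.1, ?_⟩ :
      {a // d • wt a = d • m'} → {a // wt a = m'}) fun _ _ hab => Subtype.ext (Subtype.mk.inj hab)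
    ext i
    simpa [hd] using DFunLike.congr_fun a.2 i
  · have : IsEmpty {a // d • wt a = m} := ⟨fun a => hm ⟨wt a.1, a.2.symm⟩⟩
    infer_instance

/-- Multiplication by `d ≠ 0` is injective on exponents, so the fibre over `d • m'` is the old fibre
over `m'`, and exponents not divisible by `d` have empty fibre. -/
theorem expand_weightSeries (wt : A → σ →₀ ℕ) {d : ℕ} (hd : d ≠ 0) :
    MvPowerSeries.expand d hd (weightSeries wt) = weightSeries fun a => d • wt a := by
  ext m
  by_cases hm : ∀ i, d ∣ m i
  · obtain ⟨m', rfl⟩ : ∃ m', m = d • m' := by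
      refine ⟨m.mapRange (· / d) (by simp), ?_⟩
      ext i
      simp [Nat.mul_div_cancel' (hm i)]
    rw [MvPowerSeries.coeff_expand_smul, coeff_weightSeries, coeff_weightSeries]
    refine congrArg _ (Nat.card_congr (Equiv.subtypeEquivRight fun a => ?_))
    constructor
    · rintro rfl; rfl
    · intro h
      ext i
      have := DFunLike.congr_fun h i
      simpa [hd] using this
  · push Not at hm
    obtain ⟨i, hi⟩ := hm
    rw [MvPowerSeries.coeff_expand_of_not_dvd _ _ _ hi, coeff_weightSeries]
    have : IsEmpty {a // d • wt a = m} := ⟨fun a => hi (by rw [← a.2]; simp)⟩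
    simp

end WeightSeries

/-! ### Contents, power sums and the functionals dual to the Schur functions -/

section Content

variable {X Y : Type*} [Fintype X] [Fintype Y]

/-- The content of a map to `ℕ`: the sizes of its fibres. -/
def content (f : X → ℕ) : ℕ →₀ ℕ := ∑ x, Finsupp.single (f x) 1

theorem content_apply (f : X → ℕ) (j : ℕ) : content f j = Nat.card {x // f x = j} := by
  classical
  rw [content, Finsupp.finsetSum_apply, Nat.card_eq_fintype_card, Fintype.card_subtype,
    Finset.card_filter]
  simp [Finsupp.single_apply]

theorem content_comp (f : X → ℕ) (e : Y ≃ X) : content (f ∘ e) = content f :=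
  Fintype.sum_equiv e _ _ fun _ => rfl

theorem content_ne_zero (f : X → ℕ) (x : X) : content f (f x) ≠ 0 := by
  rw [content_apply]
  have : Nonempty {y // f y = f x} := ⟨⟨x, rfl⟩⟩
  exact Nat.card_pos.ne'

/-- A map takes its values in the finite support of its content. -/
theorem finiteFibres_content : FiniteFibres (content : (X → ℕ) → ℕ →₀ ℕ) := by
  intro m
  refine Finite.of_injective
    (fun f x => ⟨f.1 x, ?_⟩ : {f : X → ℕ // content f = m} → X → m.support) ?_
  · obtain ⟨f, rfl⟩ := f
    exact Finsupp.mem_support_iff.2 (content_ne_zero f x)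
  · intro f f' h
    ext x
    exact congrArg Subtype.val (congrFun h x)

theorem FiniteFibres.restrict {A σ : Type*} {wt : A → σ →₀ ℕ} (h : FiniteFibres wt) (p : A → Prop) :
    FiniteFibres fun a : {a // p a} => wt a.1 := fun m =>
  have := h m
  Finite.of_injective (fun a => ⟨a.1.1, a.2⟩ : {a : {a // p a} // wt a.1 = m} → {a // wt a = m})
    fun _ _ hab => Subtype.ext (Subtype.ext (Subtype.mk.inj hab))

/-- The power sum attached to the cycle type of a permutation `g`: the generating series of the maps
to `ℕ` fixed by `g`. -/
def fixSeries (g : Equiv.Perm X) : MvPowerSeries ℕ ℤ :=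
  weightSeries fun f : {f : X → ℕ // ∀ x, f (g x) = f x} => content f.1

theorem coeff_fixSeries (g : Equiv.Perm X) (m : ℕ →₀ ℕ) :
    MvPowerSeries.coeff m (fixSeries g) =
      (Nat.card {f : X → ℕ // (∀ x, f (g x) = f x) ∧ content f = m} : ℤ) :=
  congrArg _ (Nat.card_congr (Equiv.subtypeSubtypeEquivSubtypeInter
    (fun f : X → ℕ => ∀ x, f (g x) = f x) fun f => content f = m))

theorem fixSeries_permCongr (e : X ≃ Y) (g : Equiv.Perm X) :
    fixSeries (e.permCongr g) = fixSeries g := by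
  refine (weightSeries_congr ((e.arrowCongr (Equiv.refl ℕ)).subtypeEquiv fun f => ?_)
    fun f => ?_).symm
  · constructor
    · intro h y
      simp [h]
    · intro h x
      simpa using h (e x)
  · exact content_comp f.1 e.symm

/-- Renaming the values of a map by `τ` does not affect being fixed by `g`. All symmetry in the
variables used later comes from this. -/
theorem coeff_fixSeries_equivMapDomain (g : Equiv.Perm X) (τ : Equiv.Perm ℕ) (m : ℕ →₀ ℕ) :
    MvPowerSeries.coeff (m.equivMapDomain τ) (fixSeries g) =
      MvPowerSeries.coeff m (fixSeries g) := by
  rw [coeff_fixSeries, coeff_fixSeries]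
  refine congrArg _ (Nat.card_congr (((Equiv.refl X).arrowCongr τ).subtypeEquiv fun f => ?_)).symm
  refine and_congr ?_ ?_
  · exact forall_congr' fun x => τ.injective.eq_iff.symm
  · have : content (((Equiv.refl X).arrowCongr τ) f) = (content f).equivMapDomain τ := by
      ext j
      rw [Finsupp.equivMapDomain_apply, content_apply, content_apply]
      exact Nat.card_congr (Equiv.subtypeEquivRight fun x => (Equiv.eq_symm_apply τ).symm)
    rw [this]
    constructor
    · rintro rfl; rfl
    · intro h
      ext j
      have := DFunLike.congr_fun h (τ j)
      simpa using this

/-- The exponent with entries `a_0, …, a_{l-1}`. -/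
def natExponent {l : ℕ} (a : Fin l → ℤ) : ℕ →₀ ℕ := ∑ i : Fin l, Finsupp.single (i : ℕ) (a i).toNat

theorem natExponent_apply {l : ℕ} (a : Fin l → ℤ) (i : Fin l) :
    natExponent a i = (a i).toNat := by
  rw [natExponent, Finsupp.finsetSum_apply, Finset.sum_eq_single i]
  · simp
  · intro j _ hj
    exact Finsupp.single_eq_of_ne (by simpa [Fin.ext_iff] using hj.symm)
  · simp

theorem natExponent_apply_of_le {l : ℕ} (a : Fin l → ℤ) {j : ℕ} (hj : l ≤ j) :
    natExponent a j = 0 := by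
  rw [natExponent, Finsupp.finsetSum_apply]
  exact Finset.sum_eq_zero fun i _ => Finsupp.single_eq_of_ne (by omega)

/-- The coefficient of `x_0^{a_0} ⋯ x_{l-1}^{a_{l-1}}`, which is zero if some `a_i` is negative. -/
def intCoeff {l : ℕ} (a : Fin l → ℤ) : MvPowerSeries ℕ ℤ →+ ℤ :=
  open Classical in
  if ∀ i, 0 ≤ a i then (MvPowerSeries.coeff (natExponent a)).toAddMonoidHom else 0

theorem intCoeff_of_nonneg {l : ℕ} {a : Fin l → ℤ} (ha : ∀ i, 0 ≤ a i) (F : MvPowerSeries ℕ ℤ) :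
    intCoeff a F = MvPowerSeries.coeff (natExponent a) F := by
  rw [intCoeff, if_pos ha]
  rfl

theorem intCoeff_of_neg {l : ℕ} {a : Fin l → ℤ} {i : Fin l} (hi : a i < 0)
    (F : MvPowerSeries ℕ ℤ) : intCoeff a F = 0 := by
  rw [intCoeff, if_neg fun h => absurd (h i) (not_le.2 hi)]
  rfl

/-- Both sides count fixed maps with prescribed fibre sizes: a map to `ℕ` whose content is
`natExponent a` automatically takes values below `l`. A negative entry makes both sides zero, which
is why `intCoeff` treats it separately instead of truncating by `toNat`. -/
theorem youngPermChar_eq_intCoeff {l : ℕ} (a : Fin l → ℤ) (g : Equiv.Perm X) :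
    youngPermChar a g = intCoeff a (fixSeries g) := by
  rw [youngPermChar]
  by_cases ha : ∀ i, 0 ≤ a i
  · rw [intCoeff_of_nonneg ha, coeff_fixSeries]
    refine congrArg _ (Nat.card_congr (Equiv.ofBijective
      (fun f => ⟨fun x => (f.1 x : ℕ), fun x => congrArg Fin.val (f.2.1 x), ?_⟩) ⟨?_, ?_⟩))
    · ext j
      rw [content_apply]
      by_cases hj : j < l
      · have h1 := f.2.2 ⟨j, hj⟩
        rw [show j = ((⟨j, hj⟩ : Fin l) : ℕ) from rfl, natExponent_apply, ← h1, Int.toNat_natCast]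
        exact Nat.card_congr (Equiv.subtypeEquivRight fun x => Fin.ext_iff.symm)
      · rw [natExponent_apply_of_le _ (not_lt.1 hj)]
        have : IsEmpty {x // (f.1 x : ℕ) = j} := ⟨fun x => hj (x.2 ▸ (f.1 x.1).2)⟩
        exact Nat.card_of_isEmpty
    · intro f f' h
      ext x
      exact congrFun (congrArg Subtype.val h) x
    · rintro ⟨f, hf, hm⟩
      have hl (x : X) : f x < l := by
        by_contra hx
        exact content_ne_zero f x (by rw [hm, natExponent_apply_of_le _ (not_lt.1 hx)])
      refine ⟨⟨fun x => ⟨f x, hl x⟩, fun x => by simp [hf], fun j => ?_⟩, rfl⟩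
      rw [← Int.toNat_of_nonneg (ha j), ← natExponent_apply, ← hm, content_apply]
      exact congrArg _ (Nat.card_congr (Equiv.subtypeEquivRight fun x => Fin.ext_iff))
  · push Not at ha
    obtain ⟨i, hi⟩ := ha
    have : IsEmpty {f : X → Fin l // (∀ x, f (g x) = f x) ∧
        ∀ j, (Nat.card {x : X // f x = j} : ℤ) = a j} := ⟨fun f => by
      have := f.2.2 i
      omega⟩
    rw [intCoeff_of_neg hi, Nat.card_of_isEmpty, Nat.cast_zero]

/-- The exponent `mu - δ' + s(δ')`, with `δ' = (0, 1, 2, …)`. -/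
def shiftedParts (mu : YoungDiagram) (s : Equiv.Perm (Fin (mu.colLen 0))) :
    Fin (mu.colLen 0) → ℤ :=
  fun i => (mu.rowLen (i : ℕ) : ℤ) - ((i : ℕ) : ℤ) + ((s i : ℕ) : ℤ)

/-- The linear functional which extracts the coefficient of `s_mu` from a symmetric function. -/
def schurCoord (mu : YoungDiagram) : MvPowerSeries ℕ ℤ →+ ℤ :=
  ∑ s : Equiv.Perm (Fin (mu.colLen 0)), (Equiv.Perm.sign s : ℤ) • intCoeff (shiftedParts mu s)

theorem schurCoord_apply (mu : YoungDiagram) (F : MvPowerSeries ℕ ℤ) :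
    schurCoord mu F = ∑ s : Equiv.Perm (Fin (mu.colLen 0)),
      (Equiv.Perm.sign s : ℤ) * intCoeff (shiftedParts mu s) F := by
  simp [schurCoord, AddMonoidHom.finsetSum_apply]

/-- The determinant defining `chi` and the functional `schurCoord` run over the same exponents with
the same signs. Character values thereby become linear functionals of power sums. -/
theorem chi_eq_schurCoord (mu : YoungDiagram) (g : Equiv.Perm X) :
    chi mu g = schurCoord mu (fixSeries g) := by
  rw [schurCoord_apply, chi]
  exact Finset.sum_congr rfl fun s _ => by rw [youngPermChar_eq_intCoeff]; rfl

theorem chi_inv (mu : YoungDiagram) (g : Equiv.Perm X) : chi mu g⁻¹ = chi mu g := by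
  rw [chi_eq_schurCoord, chi_eq_schurCoord]
  congr 1
  refine weightSeries_congr (Equiv.subtypeEquivRight fun f => ?_) fun _ => rfl
  constructor
  · intro h x
    simpa using (h (g x)).symm
  · intro h x
    simpa using (h (g⁻¹ x)).symm

end Content

/-! ### Young diagrams and their rows -/

section Diagrams

theorem youngDiagram_ext {mu nu : YoungDiagram} (h : ∀ i, mu.rowLen i = nu.rowLen i) :
    mu = nu := by
  ext ⟨i, j⟩
  rw [YoungDiagram.mem_cells, YoungDiagram.mem_cells, YoungDiagram.mem_iff_lt_rowLen,
    YoungDiagram.mem_iff_lt_rowLen, h]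

/-- The Young diagram with rows of lengths `b 0 ≥ b 1 ≥ ⋯ ≥ b (L - 1)`. -/
def diagramOfRows (b : ℕ → ℕ) (hb : Antitone b) (L : ℕ) : YoungDiagram where
  cells := (Finset.range L ×ˢ Finset.range (b 0)).filter fun c => c.2 < b c.1
  isLowerSet := by
    rintro ⟨i, j⟩ ⟨i', j'⟩ ⟨hi, hj⟩ h
    simp only [Finset.coe_filter, Finset.mem_product, Finset.mem_range, Set.mem_ofPred_eq] at h ⊢
    simp only at hi hj
    have := hb hi
    omega

theorem rowLen_diagramOfRows (b : ℕ → ℕ) (hb : Antitone b) (L : ℕ) (hL : b L = 0) (i : ℕ) :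
    (diagramOfRows b hb L).rowLen i = b i := by
  refine eq_of_forall_lt_iff fun j => ?_
  rw [← YoungDiagram.mem_iff_lt_rowLen, ← YoungDiagram.mem_cells]
  simp only [diagramOfRows, Finset.mem_filter, Finset.mem_product, Finset.mem_range]
  refine ⟨fun h => h.2, fun h => ⟨⟨?_, h.trans_le (hb (Nat.zero_le i))⟩, h⟩⟩
  by_contra hi
  have := hb (not_lt.1 hi)
  omega

theorem rowLen_eq_zero_of_le {mu : YoungDiagram} {L i : ℕ} (hL : mu.rowLen L = 0) (hi : L ≤ i) :
    mu.rowLen i = 0 :=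
  Nat.le_zero.1 (hL ▸ mu.rowLen_anti L i hi)

theorem rowLen_colLen (mu : YoungDiagram) : mu.rowLen (mu.colLen 0) = 0 := by
  by_contra h
  have h1 : (mu.colLen 0, 0) ∈ mu := YoungDiagram.mem_iff_lt_rowLen.2 (Nat.pos_of_ne_zero h)
  exact lt_irrefl _ (YoungDiagram.mem_iff_lt_colLen.1 h1)

theorem card_filter_row_lt (mu : YoungDiagram) (k : ℕ) :
    (mu.cells.filter fun c => c.1 < k).card = ∑ i ∈ Finset.range k, mu.rowLen i := by
  rw [Finset.card_eq_sum_card_fiberwise (f := Prod.fst) (t := Finset.range k)]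
  · refine Finset.sum_congr rfl fun i hi => ?_
    rw [YoungDiagram.rowLen_eq_card, YoungDiagram.row, Finset.filter_filter]
    congr 1
    ext c
    simp only [Finset.mem_filter]
    have := Finset.mem_range.1 hi
    constructor
    · rintro ⟨h, -, h'⟩; exact ⟨h, h'⟩
    · rintro ⟨h, rfl⟩; exact ⟨h, this, rfl⟩
  · intro c hc
    simpa using (Finset.mem_filter.1 hc).2

theorem card_eq_sum_rowLen {mu : YoungDiagram} {L : ℕ} (hL : mu.rowLen L = 0) :
    mu.card = ∑ i ∈ Finset.range L, mu.rowLen i := by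
  rw [← card_filter_row_lt, Finset.filter_true_of_mem]
  rintro ⟨i, j⟩ h
  by_contra hi
  rw [YoungDiagram.mem_cells, YoungDiagram.mem_iff_lt_rowLen,
    rowLen_eq_zero_of_le hL (not_lt.1 hi)] at h
  omega

end Diagrams

/-! ### Complete homogeneous symmetric polynomials -/

section Complete

/-- The complete homogeneous symmetric polynomial `h_r(x_0, …, x_{k-1})`, zero for `r < 0`. -/
def hPoly (k : ℕ) (r : ℤ) : MvPowerSeries ℕ ℤ :=
  weightSeries fun m : {m : ℕ →₀ ℕ // (∀ j, k ≤ j → m j = 0) ∧ (m.degree : ℤ) = r} => m.1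

theorem finiteFibres_of_injective {A σ : Type*} {wt : A → σ →₀ ℕ} (h : Function.Injective wt) :
    FiniteFibres wt := fun m =>
  have : Subsingleton {a // wt a = m} := ⟨fun a b => Subtype.ext (h (a.2.trans b.2.symm))⟩
  inferInstance

theorem FiniteFibres.comp {A B σ : Type*} {wt : A → σ →₀ ℕ} (h : FiniteFibres wt) {f : B → A}
    (hf : Function.Injective f) : FiniteFibres fun b => wt (f b) := fun m =>
  have := h m
  Finite.of_injective (fun b => ⟨f b.1, b.2⟩ : {b : B // wt (f b) = m} → {a // wt a = m})
    fun _ _ hab => Subtype.ext (hf (Subtype.mk.inj hab))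

open Classical in
theorem coeff_hPoly (k : ℕ) (r : ℤ) (m : ℕ →₀ ℕ) :
    MvPowerSeries.coeff m (hPoly k r) =
      if (∀ j, k ≤ j → m j = 0) ∧ (m.degree : ℤ) = r then 1 else 0 := by
  rw [hPoly, coeff_weightSeries]
  split_ifs with h
  · have : Unique {a : {m : ℕ →₀ ℕ // (∀ j, k ≤ j → m j = 0) ∧ (m.degree : ℤ) = r} // a.1 = m} :=
      ⟨⟨⟨⟨m, h⟩, rfl⟩⟩, fun a => Subtype.ext (Subtype.ext a.2)⟩
    rw [Nat.card_unique, Nat.cast_one]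
  · have : IsEmpty {a : {m : ℕ →₀ ℕ // (∀ j, k ≤ j → m j = 0) ∧ (m.degree : ℤ) = r} // a.1 = m} :=
      ⟨fun a => h (a.2 ▸ a.1.2)⟩
    rw [Nat.card_of_isEmpty, Nat.cast_zero]

theorem hPoly_of_neg (k : ℕ) {r : ℤ} (hr : r < 0) : hPoly k r = 0 := by
  ext m
  rw [coeff_hPoly, if_neg (by rintro ⟨-, h⟩; omega), map_zero]

theorem hPoly_zero (r : ℤ) : hPoly 0 r = if r = 0 then 1 else 0 := by
  classical
  ext m
  rw [coeff_hPoly]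
  have h : (∀ j, 0 ≤ j → m j = 0) ↔ m = 0 :=
    ⟨fun h => Finsupp.ext fun j => h j (Nat.zero_le j), fun h => by simp [h]⟩
  rw [h]
  by_cases hm : m = 0
  · subst hm
    by_cases hr : r = 0 <;> simp [hr, MvPowerSeries.coeff_one, eq_comm]
  · by_cases hr : r = 0 <;> simp [hr, hm, MvPowerSeries.coeff_one]

/-- Monomials are split according to whether `x_k` divides them. -/
theorem hPoly_succ (k : ℕ) (r : ℤ) :
    hPoly (k + 1) r = hPoly k r + MvPowerSeries.X k * hPoly (k + 1) (r - 1) := by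
  classical
  ext m
  rw [map_add, MvPowerSeries.X_def, MvPowerSeries.coeff_monomial_mul, one_mul]
  simp only [coeff_hPoly]
  have hle : Finsupp.single k 1 ≤ m ↔ m k ≠ 0 := by
    rw [Finsupp.single_le_iff]
    omega
  by_cases hk : m k = 0
  · have h : (∀ j, k + 1 ≤ j → m j = 0) ↔ ∀ j, k ≤ j → m j = 0 :=
      ⟨fun h j hj => by
        rcases hj.eq_or_lt with rfl | hj
        · exact hk
        · exact h j hj, fun h j hj => h j (by omega)⟩
    rw [if_neg (fun h' => hle.1 h' hk), h, add_zero]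
  · have h1 : ¬ ∀ j, k ≤ j → m j = 0 := fun h => hk (h k le_rfl)
    obtain ⟨m', rfl⟩ : ∃ m', m = m' + Finsupp.single k 1 :=
      ⟨m - Finsupp.single k 1, (tsub_add_cancel_of_le (hle.2 hk)).symm⟩
    have h2 : (∀ j, k + 1 ≤ j → (m' + Finsupp.single k 1 : ℕ →₀ ℕ) j = 0) ↔ ∀ j, k + 1 ≤ j → m' j = 0 :=
      forall_congr' fun j => imp_congr_right fun hj => by
        rw [Finsupp.add_apply, Finsupp.single_eq_of_ne (by omega), add_zero]
    have h3 : (((m' + Finsupp.single k 1).degree : ℕ) : ℤ) = r ↔ (m'.degree : ℤ) = r - 1 := by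
      rw [map_add, Finsupp.degree_single]
      push_cast
      omega
    rw [if_pos (hle.2 hk), add_tsub_cancel_right, if_congr (and_congr h2 h3) rfl rfl,
      if_neg (c := (∀ j, k ≤ j → (m' + Finsupp.single k 1 : ℕ →₀ ℕ) j = 0) ∧ _) fun h => h1 h.1,
      zero_add]

/-- Iterating `hPoly_succ` `p` times telescopes. This is the row operation that removes the last
variable from the Jacobi–Trudi matrix. -/
theorem hPoly_succ_sub (k : ℕ) (r : ℤ) (p : ℕ) :
    hPoly (k + 1) r - MvPowerSeries.X k ^ p * hPoly (k + 1) (r - p) =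
      ∑ t ∈ Finset.range p, MvPowerSeries.X k ^ t * hPoly k (r - t) := by
  induction p with
  | zero => simp
  | succ p ih =>
    rw [Finset.sum_range_succ, ← ih, hPoly_succ k (r - p), pow_succ]
    rw [show r - ((p + 1 : ℕ) : ℤ) = r - p - 1 by push_cast; ring]
    ring

end Complete

/-! ### The Jacobi–Trudi identity -/

section JacobiTrudi

open MvPowerSeries in
/-- Expansion of the Jacobi–Trudi determinant in the last variable. -/
theorem det_hPoly_succ (k L : ℕ) (lam : ℕ → ℕ) (hlam : Antitone lam) (hL : lam L = 0) :
    (Matrix.of fun i j : Fin L => hPoly (k + 1) ((lam i : ℤ) - (i : ℕ) + (j : ℕ))).det =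
      ∑ t ∈ Fintype.piFinset fun i : Fin L => Finset.range (lam i - lam (i + 1) + 1),
        X k ^ (∑ i, t i) *
          (Matrix.of fun i j : Fin L => hPoly k ((lam i : ℤ) - t i - (i : ℕ) + (j : ℕ))).det := by
  set A := Matrix.of fun i j : Fin L => hPoly (k + 1) ((lam i : ℤ) - (i : ℕ) + (j : ℕ)) with hA
  -- The shift that aligns consecutive rows: `lam (i+1) - (i+1) = (lam i - i) - p i`. Multiplying by
  -- the unipotent matrix `U` subtracts `x_k ^ p i` times row `i + 1` from row `i`, and
  -- `hPoly_succ_sub` then applies to every entry.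
  set p : ℕ → ℕ := fun i => lam i - lam (i + 1) + 1 with hp
  let U : Matrix (Fin L) (Fin L) (MvPowerSeries ℕ ℤ) := Matrix.of fun i j =>
    if i = j then 1 else if (i : ℕ) + 1 = j then - X k ^ p i else 0
  have hU : U.det = 1 := by
    rw [Matrix.det_of_isUpperTriangular]
    · simp [U]
    · intro i j hij
      have h1 : i ≠ j := fun h => by simp [h] at hij
      have h2 : ¬ (i : ℕ) + 1 = j := by
        simp only [id] at hij
        have : (j : ℕ) < i := hij
        omega
      simp [U, h1, h2]
  have hUA : U * A = Matrix.of fun i j : Fin L => ∑ t ∈ Finset.range (p i),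
      X k ^ t * hPoly k ((lam i : ℤ) - t - (i : ℕ) + (j : ℕ)) := by
    ext1 i j
    rw [Matrix.mul_apply, Matrix.of_apply]
    have hr : ∀ t : ℕ, (lam i : ℤ) - t - (i : ℕ) + (j : ℕ) = (lam i - (i : ℕ) + (j : ℕ)) - t :=
      fun t => by ring
    simp only [hr]
    rw [← hPoly_succ_sub]
    have hi1 := hlam (Nat.le_succ (i : ℕ))
    simp only [Nat.succ_eq_add_one] at hi1
    by_cases hi : (i : ℕ) + 1 < L
    · have hne : (⟨i + 1, hi⟩ : Fin L) ≠ i := fun h => by simp [Fin.ext_iff] at h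
      rw [Finset.sum_eq_add_of_mem i ⟨i + 1, hi⟩ (Finset.mem_univ _) (Finset.mem_univ _) hne.symm]
      · have hz : ((lam (i + 1) : ℤ) - ((i : ℕ) + 1 : ℕ) + (j : ℕ)) =
            (lam i - (i : ℕ) + (j : ℕ)) - p i := by
          simp only [hp]
          push_cast [hi1]
          ring
        simp only [U, hA, Matrix.of_apply, if_neg hne.symm, if_true, one_mul, hz]
        ring
      · rintro c - ⟨hc1, hc2⟩
        have h1 : ¬ (i : ℕ) + 1 = c := fun h => hc2 (Fin.ext h.symm)
        simp [U, hc1.symm, h1]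
    -- The last row has nothing below it to subtract, but the missing term has index `j - L < 0`
    -- because `lam L = 0`.
    · have hz : hPoly (k + 1) ((lam i - (i : ℕ) + (j : ℕ)) - p i : ℤ) = 0 := by
        apply hPoly_of_neg
        have h2 : (i : ℕ) + 1 = L := by omega
        rw [h2] at hi1
        simp only [hp, h2, hL]
        have := j.2
        push_cast
        omega
      rw [Finset.sum_eq_single i, hz]
      · simp [U, hA]
      · intro c _ hc
        have h1 : ¬ (i : ℕ) + 1 = c := by omega
        simp [U, hc.symm, h1]
      · simp
  rw [← one_mul A.det, ← hU, ← Matrix.det_mul, hUA]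
  -- Multilinearity in the rows: one exponent `t i < p i` is chosen per row, and the powers of `x_k`
  -- factor out row by row.
  have h := (Matrix.detRowAlternating (n := Fin L) (R := MvPowerSeries ℕ ℤ)).toMultilinearMap.map_sum_finset
    (fun (i : Fin L) (t : ℕ) (j : Fin L) =>
      X k ^ t * hPoly k ((lam i : ℤ) - t - (i : ℕ) + (j : ℕ)))
    fun i => Finset.range (p i)
  have e1 : (Matrix.of fun i j : Fin L => ∑ t ∈ Finset.range (p i),
      X k ^ t * hPoly k ((lam i : ℤ) - t - (i : ℕ) + (j : ℕ))) =
      fun i : Fin L => ∑ t ∈ Finset.range (p i), fun j : Fin L =>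
        X k ^ t * hPoly k ((lam i : ℤ) - t - (i : ℕ) + (j : ℕ)) := by
    ext1 i j
    simp [Finset.sum_apply]
  rw [e1]
  refine h.trans (Finset.sum_congr rfl fun t _ => ?_)
  rw [← Finset.prod_pow_eq_pow_sum, ← Matrix.det_mul_column]
  rfl

/-! ### Tableaux and the branching rule for Schur polynomials -/

/-- The weight of a tableau: the number of entries equal to `k`, for each `k`. -/
def tableauWeight {lam : YoungDiagram} (T : SemistandardYoungTableau lam) : ℕ →₀ ℕ :=
  ∑ c ∈ lam.cells, Finsupp.single (T c.1 c.2) 1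

theorem tableauWeight_apply {lam : YoungDiagram} (T : SemistandardYoungTableau lam) (k : ℕ) :
    tableauWeight T k = (lam.cells.filter fun c => T c.1 c.2 = k).card := by
  rw [tableauWeight, Finsupp.finsetSum_apply, Finset.card_filter]
  simp [Finsupp.single_apply]

theorem schur_eq_weightSeries (lam : YoungDiagram) :
    schur lam = weightSeries (tableauWeight (lam := lam)) := by
  funext m
  refine congrArg _ (Nat.card_congr (Equiv.subtypeEquivRight fun T => ?_))
  rw [Finsupp.ext_iff]
  exact forall_congr' fun k => by rw [tableauWeight_apply]

theorem finiteFibres_tableauWeight (lam : YoungDiagram) :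
    FiniteFibres (tableauWeight (lam := lam)) := by
  intro m
  refine Finite.of_injective (fun T c => ⟨T.1 c.1.1 c.1.2, ?_⟩ :
    {T : SemistandardYoungTableau lam // tableauWeight T = m} → lam.cells → m.support) ?_
  · obtain ⟨T, rfl⟩ := T
    rw [Finsupp.mem_support_iff, tableauWeight_apply]
    exact Finset.card_ne_zero.2 ⟨c.1, Finset.mem_filter.2 ⟨c.2, rfl⟩⟩
  · intro T T' h
    ext i j
    by_cases hc : (i, j) ∈ lam
    · exact congrArg Subtype.val (congrFun h ⟨(i, j), (YoungDiagram.mem_cells _).2 hc⟩)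
    · rw [T.1.zeros hc, T'.1.zeros hc]

/-- Tableaux with entries `< k`. -/
abbrev BoundedTableau (k : ℕ) (lam : YoungDiagram) : Type :=
  {T : SemistandardYoungTableau lam // ∀ i j, (i, j) ∈ lam → T i j < k}

/-- The Schur polynomial in the variables `x_0, …, x_{k-1}`. -/
def schurPoly (k : ℕ) (lam : YoungDiagram) : MvPowerSeries ℕ ℤ :=
  weightSeries fun T : BoundedTableau k lam => tableauWeight T.1

theorem coeff_schurPoly {k : ℕ} {m : ℕ →₀ ℕ} (hm : ∀ j, k ≤ j → m j = 0) (lam : YoungDiagram) :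
    MvPowerSeries.coeff m (schurPoly k lam) = MvPowerSeries.coeff m (schur lam) := by
  rw [schur_eq_weightSeries, schurPoly, coeff_weightSeries, coeff_weightSeries]
  refine congrArg _ (Nat.card_congr (Equiv.subtypeSubtypeEquivSubtype
    (p := fun T : SemistandardYoungTableau lam => ∀ i j, (i, j) ∈ lam → T i j < k)
    (q := fun T => tableauWeight T = m) fun {T} hT i j hc => ?_))
  by_contra hk
  have h1 := hm _ (not_lt.1 hk)
  rw [← hT, tableauWeight_apply, Finset.card_eq_zero] at h1
  exact Finset.notMem_empty (i, j) (h1 ▸ Finset.mem_filter.2 ⟨(YoungDiagram.mem_cells _).2 hc, rfl⟩)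

/-- The diagrams `nu ⊆ lam` such that `lam / nu` is a horizontal strip. -/
abbrev Strip (lam : YoungDiagram) : Type :=
  {nu : YoungDiagram // nu ≤ lam ∧ ∀ i j, (i + 1, j) ∈ lam → (i, j) ∈ nu}

instance (lam : YoungDiagram) : Finite (Strip lam) :=
  Finite.of_injective (fun nu => ⟨nu.1.cells, Finset.mem_powerset.2 nu.2.1⟩ :
    Strip lam → lam.cells.powerset) fun nu nu' h => by
      have := congrArg Subtype.val h
      exact Subtype.ext (YoungDiagram.ext this)

/-- Fill the horizontal strip `lam / nu` with the entry `k`. -/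
def fillStrip (k : ℕ) {lam : YoungDiagram} (nu : Strip lam) (T : BoundedTableau k nu.1) :
    BoundedTableau (k + 1) lam where
  val :=
    { entry := fun i j => if (i, j) ∈ nu.1 then T.1 i j else if (i, j) ∈ lam then k else 0
      row_weak' := by
        intro i j1 j2 hj h2
        have h1 : (i, j1) ∈ lam := lam.up_left_mem le_rfl hj.le h2
        by_cases hn2 : (i, j2) ∈ nu.1
        · have hn1 : (i, j1) ∈ nu.1 := nu.1.up_left_mem le_rfl hj.le hn2
          rw [if_pos hn1, if_pos hn2]
          exact T.1.row_weak hj hn2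
        · rw [if_neg hn2, if_pos h2]
          split_ifs with hn1
          · exact (T.2 _ _ hn1).le
          · exact le_rfl
      col_strict' := by
        intro i1 i2 j hi h2
        have hn1 : (i1, j) ∈ nu.1 := nu.2.2 i1 j (lam.up_left_mem hi le_rfl h2)
        rw [if_pos hn1]
        split_ifs with hn2
        · exact T.1.col_strict hi hn2
        · exact T.2 _ _ hn1
      zeros' := by
        intro i j h
        rw [if_neg fun hn => h (nu.2.1 hn), if_neg h] }
  property := by
    intro i j h
    change (if (i, j) ∈ nu.1 then T.1 i j else if (i, j) ∈ lam then k else 0) < k + 1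
    split_ifs with hn
    · exact (T.2 _ _ hn).trans (Nat.lt_succ_self k)
    · exact Nat.lt_succ_self k

theorem fillStrip_apply (k : ℕ) {lam : YoungDiagram} (nu : Strip lam) (T : BoundedTableau k nu.1)
    (i j : ℕ) : (fillStrip k nu T).1 i j =
      if (i, j) ∈ nu.1 then T.1 i j else if (i, j) ∈ lam then k else 0 := rfl

theorem fillStrip_lt_iff (k : ℕ) {lam : YoungDiagram} (nu : Strip lam) (T : BoundedTableau k nu.1)
    {i j : ℕ} (h : (i, j) ∈ lam) : (fillStrip k nu T).1 i j < k ↔ (i, j) ∈ nu.1 := by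
  rw [fillStrip_apply]
  split_ifs with hn
  · exact ⟨fun _ => hn, fun _ => T.2 _ _ hn⟩
  · simp [hn]

/-- The inverse keeps the cells with entry below `k`. They form a diagram because entries increase
weakly along rows and columns, and what is removed is a horizontal strip because a strictly
increasing column contains `k` at most once, at its bottom. -/
theorem fillStrip_bijective (k : ℕ) (lam : YoungDiagram) : Function.Bijective
    fun p : (Σ nu : Strip lam, BoundedTableau k nu.1) => fillStrip k p.1 p.2 := by
  constructor
  · rintro ⟨nu, T⟩ ⟨nu', T'⟩ h
    have h' : ∀ i j, (fillStrip k nu T).1 i j = (fillStrip k nu' T').1 i j := fun i j => by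
      simp only at h
      rw [h]
    obtain rfl : nu = nu' := by
      refine Subtype.ext (YoungDiagram.ext (Finset.ext ?_))
      rintro ⟨i, j⟩
      rw [YoungDiagram.mem_cells, YoungDiagram.mem_cells]
      by_cases hc : (i, j) ∈ lam
      · rw [← fillStrip_lt_iff k nu T hc, ← fillStrip_lt_iff k nu' T' hc, h']
      · exact ⟨fun hn => absurd (nu.2.1 hn) hc, fun hn => absurd (nu'.2.1 hn) hc⟩
    congr 1
    ext i j
    by_cases hn : (i, j) ∈ nu.1
    · have := h' i j
      rwa [fillStrip_apply, fillStrip_apply, if_pos hn, if_pos hn] at this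
    · rw [T.1.zeros hn, T'.1.zeros hn]
  · rintro ⟨T, hT⟩
    let nu : YoungDiagram :=
      { cells := lam.cells.filter fun c => T c.1 c.2 < k
        isLowerSet := by
          rintro ⟨i, j⟩ ⟨i', j'⟩ ⟨hi, hj⟩ h
          simp only [Finset.coe_filter, YoungDiagram.mem_cells, Set.mem_ofPred_eq] at h ⊢
          simp only at hi hj
          have h1 := lam.up_left_mem hi hj h.1
          exact ⟨h1, ((T.col_weak hi (lam.up_left_mem le_rfl hj h.1)).trans
            (T.row_weak_of_le hj h.1)).trans_lt h.2⟩ }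
    have hnu (i j : ℕ) : (i, j) ∈ nu ↔ (i, j) ∈ lam ∧ T i j < k := by
      rw [← YoungDiagram.mem_cells]
      simp [nu]
    refine ⟨⟨⟨nu, Finset.filter_subset _ _, fun i j h => ?_⟩, ⟨⟨fun i j =>
      if (i, j) ∈ nu then T i j else 0, ?_, ?_, ?_⟩, ?_⟩⟩, ?_⟩
    · rw [hnu]
      refine ⟨lam.up_left_mem (Nat.le_succ i) le_rfl h, ?_⟩
      have h1 := hT _ _ h
      have h2 := T.col_strict (Nat.lt_succ_self i) h
      simp only [Nat.succ_eq_add_one] at h2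
      omega
    · intro i j1 j2 hj h
      rw [if_pos h, if_pos (nu.up_left_mem le_rfl hj.le h)]
      exact T.row_weak hj ((hnu _ _).1 h).1
    · intro i1 i2 j hi h
      rw [if_pos h, if_pos (nu.up_left_mem hi.le le_rfl h)]
      exact T.col_strict hi ((hnu _ _).1 h).1
    · intro i j h
      rw [if_neg h]
    · intro i j h
      change (if (i, j) ∈ nu then T i j else 0) < k
      rw [if_pos h]
      exact ((hnu _ _).1 h).2
    · refine Subtype.ext (SemistandardYoungTableau.ext fun i j => ?_)
      change (if (i, j) ∈ nu then (if (i, j) ∈ nu then T i j else 0)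
        else if (i, j) ∈ lam then k else 0) = T i j
      by_cases hn : (i, j) ∈ nu
      · rw [if_pos hn, if_pos hn]
      · rw [if_neg hn]
        by_cases hc : (i, j) ∈ lam
        · rw [if_pos hc]
          have h1 := hT _ _ hc
          rw [hnu] at hn
          have h2 : ¬ T i j < k := fun h => hn ⟨hc, h⟩
          omega
        · rw [if_neg hc, T.zeros hc]

theorem tableauWeight_fillStrip (k : ℕ) {lam : YoungDiagram} (nu : Strip lam)
    (T : BoundedTableau k nu.1) : tableauWeight (fillStrip k nu T).1 =
      Finsupp.single k (lam.card - nu.1.card) + tableauWeight T.1 := by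
  have hsub : nu.1.cells ⊆ lam.cells := nu.2.1
  rw [tableauWeight, ← Finset.sum_sdiff hsub, tableauWeight]
  congr 1
  · rw [Finset.sum_congr rfl (g := fun _ => Finsupp.single k 1)]
    · rw [Finset.sum_const, Finset.card_sdiff_of_subset hsub, Finsupp.smul_single, smul_eq_mul,
        mul_one]
    · rintro ⟨i, j⟩ hc
      rw [Finset.mem_sdiff, YoungDiagram.mem_cells, YoungDiagram.mem_cells] at hc
      rw [fillStrip_apply, if_neg hc.2, if_pos hc.1]
  · refine Finset.sum_congr rfl ?_
    rintro ⟨i, j⟩ hc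
    rw [YoungDiagram.mem_cells] at hc
    rw [fillStrip_apply, if_pos hc]

/-- The branching rule: tableaux are sorted by the position of the entries equal to `k`. It matches
the expansion `det_hPoly_succ` of the determinant. -/
theorem schurPoly_succ (k : ℕ) (lam : YoungDiagram) [Fintype (Strip lam)] :
    schurPoly (k + 1) lam =
      ∑ nu : Strip lam, MvPowerSeries.X k ^ (lam.card - nu.1.card) * schurPoly k nu.1 := by
  have hf (nu : Strip lam) : FiniteFibres fun T : BoundedTableau k nu.1 => tableauWeight T.1 :=
    (finiteFibres_tableauWeight nu.1).restrict _
  have h1 (nu : Strip lam) : MvPowerSeries.X k ^ (lam.card - nu.1.card) * schurPoly k nu.1 =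
      weightSeries fun T : BoundedTableau k nu.1 => tableauWeight (fillStrip k nu T).1 := by
    rw [schurPoly, X_pow_mul_weightSeries (hf nu)]
    simp only [tableauWeight_fillStrip]
  rw [Finset.sum_congr rfl fun nu _ => h1 nu,
    ← weightSeries_sigma fun (nu : Strip lam) (T : BoundedTableau k nu.1) =>
      tableauWeight (fillStrip k nu T).1]
  · exact (weightSeries_congr (Equiv.ofBijective _ (fillStrip_bijective k lam)) fun _ => rfl).symm
  · intro nu
    exact (((finiteFibres_tableauWeight lam).restrict fun T => ∀ i j, (i, j) ∈ lam → T i j < k + 1).comp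
      (f := fillStrip k nu) fun T T' h => by
        have := (fillStrip_bijective k lam).1 (a₁ := ⟨nu, T⟩) (a₂ := ⟨nu, T'⟩) h
        simpa using this)

theorem schurPoly_zero (lam : YoungDiagram) : schurPoly 0 lam = if lam.card = 0 then 1 else 0 := by
  classical
  split_ifs with h
  · have hc : lam.cells = ∅ := Finset.card_eq_zero.1 h
    have hn (c : ℕ × ℕ) : c ∉ lam := by rw [← YoungDiagram.mem_cells, hc]; simp
    have : Unique (BoundedTableau 0 lam) :=
      ⟨⟨⟨default, fun i j h => absurd h (hn _)⟩⟩, fun T => Subtype.ext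
        (SemistandardYoungTableau.ext fun i j => by rw [T.1.zeros (hn _),
          SemistandardYoungTableau.zeros _ (hn _)])⟩
    have hw (T : BoundedTableau 0 lam) : tableauWeight T.1 = 0 := by
      rw [tableauWeight, hc, Finset.sum_empty]
    ext m
    rw [schurPoly, coeff_weightSeries, MvPowerSeries.coeff_one]
    simp only [hw]
    split_ifs with hm
    · subst hm
      simp
    · have : IsEmpty {_T : BoundedTableau 0 lam // 0 = m} := ⟨fun T => hm T.2.symm⟩
      rw [Nat.card_of_isEmpty, Nat.cast_zero]
  · obtain ⟨⟨i, j⟩, hc⟩ := Finset.card_ne_zero.1 h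
    have : IsEmpty (BoundedTableau 0 lam) :=
      ⟨fun T => Nat.not_lt_zero _ (T.2 i j ((YoungDiagram.mem_cells _).1 hc))⟩
    ext m
    rw [schurPoly, coeff_weightSeries, Nat.card_of_isEmpty, Nat.cast_zero, map_zero]

end JacobiTrudi

/-! ### Jacobi–Trudi by induction on the number of variables -/

section JacobiTrudi

theorem rowLen_le_of_le {nu lam : YoungDiagram} (h : nu ≤ lam) (i : ℕ) :
    nu.rowLen i ≤ lam.rowLen i := by
  refine le_of_forall_lt fun j hj => ?_
  rw [← YoungDiagram.mem_iff_lt_rowLen] at hj ⊢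
  exact h hj

theorem Strip.rowLen_succ_le {lam : YoungDiagram} (nu : Strip lam) (i : ℕ) :
    lam.rowLen (i + 1) ≤ nu.1.rowLen i := by
  refine le_of_forall_lt fun j hj => ?_
  rw [← YoungDiagram.mem_iff_lt_rowLen] at hj ⊢
  exact nu.2.2 i j hj

/-- The Jacobi–Trudi identity for Schur polynomials. -/
theorem schurPoly_eq_det (k L : ℕ) (lam : YoungDiagram) (hL : lam.rowLen L = 0) :
    schurPoly k lam =
      (Matrix.of fun i j : Fin L => hPoly k ((lam.rowLen i : ℤ) - (i : ℕ) + (j : ℕ))).det := by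
  induction k generalizing lam with
  | zero =>
    -- Without variables `h_r` is 1 for `r = 0` and 0 otherwise. The matrix is the identity for the
    -- empty diagram; otherwise its first row, with indices `lam_0 + j > 0`, vanishes.
    rw [schurPoly_zero]
    split_ifs with h
    · have h0 (i : ℕ) : lam.rowLen i = 0 := by
        have h1 := Finset.sum_eq_zero_iff.1
          ((card_eq_sum_rowLen (rowLen_eq_zero_of_le hL (le_max_left L (i + 1)))).symm.trans h) i
        exact h1 (Finset.mem_range.2 (by omega))
      rw [← Matrix.det_one (n := Fin L) (R := MvPowerSeries ℕ ℤ)]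
      congr 1
      ext1 i j
      rw [Matrix.of_apply, h0, hPoly_zero, Matrix.one_apply]
      congr 1
      rw [Fin.ext_iff]
      apply propext
      push_cast
      omega
    · have h0 : lam.rowLen 0 ≠ 0 := fun h0 => h (by
        rw [card_eq_sum_rowLen h0, Finset.range_zero, Finset.sum_empty])
      have hL0 : 0 < L := Nat.pos_of_ne_zero fun h => h0 (h ▸ hL)
      refine (Matrix.det_eq_zero_of_row_eq_zero ⟨0, hL0⟩ fun j => ?_).symm
      rw [Matrix.of_apply, hPoly_zero, if_neg]
      simp only [Nat.cast_zero]
      omega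
  | succ k ih =>
    classical
    have := Fintype.ofFinite (Strip lam)
    rw [schurPoly_succ, det_hPoly_succ k L lam.rowLen (fun i j h => lam.rowLen_anti i j h) hL]
    have hle (nu : Strip lam) (i : ℕ) := rowLen_le_of_le nu.2.1 i
    have hnuL (nu : Strip lam) : nu.1.rowLen L = 0 := by
      have := hle nu L
      omega
    -- A horizontal strip is recorded by the number of cells in each row; the interlacing `lam_{i+1}
    -- ≤ nu_i ≤ lam_i` is exactly the range of exponents in the determinant expansion.
    refine Finset.sum_bij (fun nu _ i => lam.rowLen i - nu.1.rowLen i) ?_ ?_ ?_ ?_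
    · intro nu _
      rw [Fintype.mem_piFinset]
      intro i
      rw [Finset.mem_range]
      have := nu.rowLen_succ_le i
      omega
    · intro nu _ nu' _ h
      refine Subtype.ext (youngDiagram_ext fun i => ?_)
      by_cases hi : i < L
      · have h1 := congrFun h ⟨i, hi⟩
        have h2 := hle nu i
        have h3 := hle nu' i
        simp only at h1
        omega
      · rw [rowLen_eq_zero_of_le (hnuL nu) (not_lt.1 hi),
          rowLen_eq_zero_of_le (hnuL nu') (not_lt.1 hi)]
    · intro t ht
      rw [Fintype.mem_piFinset] at ht
      set b : ℕ → ℕ := fun i => if h : i < L then lam.rowLen i - t ⟨i, h⟩ else 0 with hb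
      have hb1 (i : ℕ) : b i ≤ lam.rowLen i := by
        simp only [hb]
        split_ifs <;> omega
      have hb2 (i : ℕ) : lam.rowLen (i + 1) ≤ b i := by
        simp only [hb]
        split_ifs with h
        · have h1 := Finset.mem_range.1 (ht ⟨i, h⟩)
          have h2 := lam.rowLen_anti i (i + 1) (Nat.le_succ i)
          simp only at h1
          omega
        · rw [rowLen_eq_zero_of_le hL (by omega)]
      have hb3 : Antitone b := antitone_nat_of_succ_le fun i => (hb1 _).trans (hb2 i)
      have hbL : b L = 0 := by simp [hb]
      have hr := rowLen_diagramOfRows b hb3 L hbL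
      refine ⟨⟨diagramOfRows b hb3 L, ?_, ?_⟩, Finset.mem_univ _, ?_⟩
      · rintro ⟨i, j⟩ h
        change (i, j) ∈ diagramOfRows b hb3 L at h
        rw [YoungDiagram.mem_iff_lt_rowLen, hr] at h
        exact YoungDiagram.mem_iff_lt_rowLen.2 (h.trans_le (hb1 i))
      · intro i j h
        rw [YoungDiagram.mem_iff_lt_rowLen] at h
        rw [YoungDiagram.mem_iff_lt_rowLen, hr]
        exact h.trans_le (hb2 i)
      · funext i
        have h1 := Finset.mem_range.1 (ht i)
        have h2 := lam.rowLen_anti i (i + 1) (Nat.le_succ i)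
        have h3 : b i = lam.rowLen i - t i := by simp [hb]
        simp only [hr, h3]
        omega
    · intro nu _
      rw [ih nu.1 (hnuL nu)]
      have he : lam.card - nu.1.card = ∑ i : Fin L, (lam.rowLen i - nu.1.rowLen i) := by
        rw [card_eq_sum_rowLen hL, card_eq_sum_rowLen (hnuL nu), ← Finset.sum_range
          fun i => lam.rowLen i - nu.1.rowLen i, Finset.sum_tsub_distrib _ fun i _ => hle nu i]
      rw [he]
      congr 2
      ext1 i j
      rw [Matrix.of_apply, Matrix.of_apply]
      congr 3
      have := hle nu i
      push_cast [this]
      ring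

/-- Matrices of natural numbers with row sums `a` and column sums `m`. -/
abbrev Contingency {l : ℕ} (a : Fin l → ℤ) (m : ℕ →₀ ℕ) : Type :=
  {M : Fin l → ℕ →₀ ℕ // (∀ i, ((M i).degree : ℤ) = a i) ∧ ∑ i, M i = m}

theorem coeff_prod_hPoly {k l : ℕ} (a : Fin l → ℤ) {m : ℕ →₀ ℕ} (hm : ∀ j, k ≤ j → m j = 0) :
    MvPowerSeries.coeff m (∏ i, hPoly k (a i)) = (Nat.card (Contingency a m) : ℤ) := by
  simp only [hPoly]
  rw [prod_weightSeries _ fun i => finiteFibres_of_injective Subtype.val_injective,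
    coeff_weightSeries]
  refine congrArg _ (Nat.card_congr
    { toFun := fun M => ⟨fun i => (M.1 i).1, fun i => (M.1 i).2.2, M.2⟩
      invFun := fun M => ⟨fun i => ⟨M.1 i, fun j hj => ?_, M.2.1 i⟩, M.2.2⟩
      left_inv := fun _ => rfl
      right_inv := fun _ => rfl })
  have h := DFunLike.congr_fun M.2.2 j
  rw [hm j hj, Finsupp.finsetSum_apply, Finset.sum_eq_zero_iff] at h
  exact h i (Finset.mem_univ i)

/-- The Jacobi–Trudi identity. -/
theorem coeff_schur (lam : YoungDiagram) (m : ℕ →₀ ℕ) :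
    MvPowerSeries.coeff m (schur lam) = ∑ s : Equiv.Perm (Fin (lam.colLen 0)),
      (Equiv.Perm.sign s : ℤ) * (Nat.card (Contingency (shiftedParts lam s) m) : ℤ) := by
  obtain ⟨k, hk⟩ : ∃ k, ∀ j, k ≤ j → m j = 0 := by
    refine ⟨m.support.sup id + 1, fun j hj => ?_⟩
    by_contra h
    have : id j ≤ m.support.sup id := Finset.le_sup (Finsupp.mem_support_iff.2 h)
    simp only [id] at this
    omega
  -- The transpose makes the Leibniz product run over entries `(i, s i)`, the convention of
  -- `shiftedParts`.
  rw [← coeff_schurPoly hk, schurPoly_eq_det k _ lam (rowLen_colLen lam),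
    ← Matrix.det_transpose, Matrix.det_apply, map_sum]
  refine Finset.sum_congr rfl fun s _ => ?_
  rw [Units.smul_def, map_zsmul, smul_eq_mul]
  congr 1
  rw [← coeff_prod_hPoly _ hk]
  rfl

end JacobiTrudi

/-! ### Schur functions in terms of power sums -/

section PowerSums

variable {X : Type*} [Fintype X]

/-- Two maps with the same fibre cardinalities differ by a permutation. -/
theorem exists_perm_comp_eq {Y : Type*} {f f' : X → Y}
    (h : ∀ y, Nat.card {x // f x = y} = Nat.card {x // f' x = y}) :
    ∃ g : Equiv.Perm X, ∀ x, f' (g x) = f x := by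
  have e (y : Y) : {x // f x = y} ≃ {x // f' x = y} := (Finite.card_eq.1 (h y)).some
  refine ⟨((Equiv.sigmaFiberEquiv f).symm.trans (Equiv.sigmaCongrRight e)).trans
    (Equiv.sigmaFiberEquiv f'), fun x => ?_⟩
  exact (e (f x) ⟨x, rfl⟩).2

/-- The sizes of the fibres of a map to `Fin l × ℕ`, arranged as a matrix. -/
def jointContent {l : ℕ} (F : X → Fin l × ℕ) (i : Fin l) : ℕ →₀ ℕ :=
  ∑ x, if (F x).1 = i then Finsupp.single (F x).2 1 else 0

theorem jointContent_apply {l : ℕ} (F : X → Fin l × ℕ) (i : Fin l) (j : ℕ) :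
    jointContent F i j = Nat.card {x // F x = (i, j)} := by
  classical
  rw [jointContent, Finsupp.finsetSum_apply, Nat.card_eq_fintype_card, Fintype.card_subtype,
    Finset.card_filter]
  refine Finset.sum_congr rfl fun x _ => ?_
  by_cases h : (F x).1 = i
  · simp [h, Prod.ext_iff, Finsupp.single_apply]
  · simp [h, Prod.ext_iff]

theorem degree_jointContent {l : ℕ} (F : X → Fin l × ℕ) (i : Fin l) :
    (jointContent F i).degree = Nat.card {x // (F x).1 = i} := by
  classical
  rw [jointContent, map_sum, Nat.card_eq_fintype_card, Fintype.card_subtype, Finset.card_filter]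
  refine Finset.sum_congr rfl fun x _ => ?_
  split_ifs <;> simp

theorem sum_jointContent {l : ℕ} (F : X → Fin l × ℕ) :
    ∑ i, jointContent F i = content fun x => (F x).2 := by
  simp only [jointContent, content]
  rw [Finset.sum_comm]
  simp

theorem jointContent_comp {l : ℕ} (F : X → Fin l × ℕ) (g : Equiv.Perm X) :
    jointContent (fun x => F (g x)) = jointContent F :=
  funext fun _ => Fintype.sum_equiv g _ _ fun _ => rfl

theorem exists_jointContent_eq {l : ℕ} (M : Fin l → ℕ →₀ ℕ)
    (hM : ∑ i, (M i).degree = Fintype.card X) : ∃ F : X → Fin l × ℕ, jointContent F = M := by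
  classical
  have hc : Fintype.card (Σ i : Fin l, Σ j : (M i).support, Fin (M i j)) = Fintype.card X := by
    rw [← hM, Fintype.card_sigma]
    refine Finset.sum_congr rfl fun i _ => ?_
    rw [Fintype.card_sigma, Finsupp.degree_apply]
    simp only [Fintype.card_fin]
    exact Finset.sum_coe_sort (M i).support fun j => M i j
  let e : X ≃ Σ i : Fin l, Σ j : (M i).support, Fin (M i j) := (Fintype.equivOfCardEq hc).symm
  refine ⟨fun x => ((e x).1, (e x).2.1), funext fun i => ?_⟩
  rw [jointContent, Fintype.sum_equiv e _
    (fun y => if y.1 = i then Finsupp.single (y.2.1 : ℕ) 1 else 0) fun _ => rfl,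
    Fintype.sum_sigma, Finset.sum_eq_single i]
  · simp only [if_true]
    rw [Fintype.sum_sigma]
    simp only [Finset.sum_const, Finset.card_univ, Fintype.card_fin, Finsupp.smul_single,
      smul_eq_mul, mul_one]
    rw [Finset.sum_coe_sort (M i).support fun j => Finsupp.single j (M i j)]
    exact (M i).sum_single
  · intro i' _ hi'
    simp [hi']
  · simp

/-- The maps to `Fin l × ℕ` which are fixed by `g` and whose components have given fibre
cardinalities. -/
abbrev FixedPairs {l : ℕ} (a : Fin l → ℤ) (m : ℕ →₀ ℕ) (g : Equiv.Perm X) : Type _ :=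
  {F : X → Fin l × ℕ // (∀ x, F (g x) = F x) ∧
    (∀ i, (Nat.card {x // (F x).1 = i} : ℤ) = a i) ∧ content (fun x => (F x).2) = m}

/-- A fixed map to `Fin l × ℕ` is a pair of fixed maps. -/
def fixedPairsEquiv {l : ℕ} (a : Fin l → ℤ) (m : ℕ →₀ ℕ) (g : Equiv.Perm X) :
    {f : X → Fin l // (∀ x, f (g x) = f x) ∧ ∀ j, (Nat.card {x : X // f x = j} : ℤ) = a j} ×
      {f : X → ℕ // (∀ x, f (g x) = f x) ∧ content f = m} ≃ FixedPairs a m g where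
  toFun p := ⟨fun x => (p.1.1 x, p.2.1 x),
    fun x => Prod.ext (p.1.2.1 x) (p.2.2.1 x), p.1.2.2, p.2.2.2⟩
  invFun F := ⟨⟨fun x => (F.1 x).1, fun x => congrArg Prod.fst (F.2.1 x), F.2.2.1⟩,
    ⟨fun x => (F.1 x).2, fun x => congrArg Prod.snd (F.2.1 x), F.2.2.2⟩⟩
  left_inv _ := rfl
  right_inv _ := rfl

instance {l : ℕ} (a : Fin l → ℤ) (m : ℕ →₀ ℕ) (g : Equiv.Perm X) : Finite (FixedPairs a m g) :=
  have := finiteFibres_content (X := X) m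
  have : Finite {f : X → ℕ // (∀ x, f (g x) = f x) ∧ content f = m} :=
    Finite.of_injective (fun f => ⟨f.1, f.2.2⟩ :
        {f : X → ℕ // (∀ x, f (g x) = f x) ∧ content f = m} → {f : X → ℕ // content f = m})
      fun _ _ h => Subtype.ext (congrArg (fun f => f.1) h)
  Finite.of_equiv _ (fixedPairsEquiv a m g)

/-- Double counting of pairs of a permutation and a fixed map. -/
theorem sum_card_fixedPairs [DecidableEq X] {l : ℕ} (a : Fin l → ℤ) (m : ℕ →₀ ℕ)
    (ha : ∑ i, a i = Fintype.card X) :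
    ∑ g : Equiv.Perm X, Nat.card (FixedPairs a m g) =
      (Fintype.card X).factorial * Nat.card (Contingency a m) := by
  have hsurj (M : Contingency a m) : ∃ F : X → Fin l × ℕ, jointContent F = M.1 := by
    refine exists_jointContent_eq M.1 ?_
    have := ha
    rw [← Finset.sum_congr rfl fun i _ => M.2.1 i] at this
    exact_mod_cast this
  -- The permutations of `X` act on maps to `Fin l × ℕ`, with orbits classified by `jointContent`.
  -- `F₀ M` is a base point of the orbit of `M`, and `π` below picks for each `F` in it a
  -- permutation with `F = F₀ M ∘ π`.
  choose F₀ hF₀ using hsurj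
  have hperm (M : Contingency a m) (F : {F : X → Fin l × ℕ // jointContent F = M.1}) :
      ∃ g : Equiv.Perm X, ∀ x, F₀ M (g x) = F.1 x := exists_perm_comp_eq fun y => by
    rw [← jointContent_apply, ← jointContent_apply, F.2, hF₀]
  choose π hπ using hperm
  have hcls (F : X → Fin l × ℕ) (M : Contingency a m) (h : jointContent F = M.1) :
      (∀ i, (Nat.card {x // (F x).1 = i} : ℤ) = a i) ∧ content (fun x => (F x).2) = m := by
    refine ⟨fun i => ?_, ?_⟩
    · rw [← degree_jointContent, h, M.2.1]
    · rw [← sum_jointContent, h, M.2.2]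
  let toM (F : X → Fin l × ℕ) (h : (∀ i, (Nat.card {x // (F x).1 = i} : ℤ) = a i) ∧
      content (fun x => (F x).2) = m) : Contingency a m :=
    ⟨jointContent F, fun i => by rw [degree_jointContent, h.1], by rw [sum_jointContent, h.2]⟩
  have hF₀c (M : Contingency a m) (h : Equiv.Perm X) : jointContent (fun x => F₀ M (h x)) = M.1 := by
    rw [jointContent_comp, hF₀]
  -- Burnside's count as a bijection: since `F ∘ g = F`, the permutation `h = π_F g` again carries
  -- `F₀` to `F`. Conversely `h` determines `F = F₀ ∘ h` and then `g = π_F⁻¹ h`.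
  let e : (Σ g : Equiv.Perm X, FixedPairs a m g) ≃ Equiv.Perm X × Contingency a m :=
    { toFun := fun p => (π (toM p.2.1 p.2.2.2) ⟨p.2.1, rfl⟩ * p.1, toM p.2.1 p.2.2.2)
      invFun := fun q => ⟨(π q.2 ⟨fun x => F₀ q.2 (q.1 x), hF₀c q.2 q.1⟩)⁻¹ * q.1,
        ⟨fun x => F₀ q.2 (q.1 x), fun x => by
          have h := hπ q.2 ⟨fun x => F₀ q.2 (q.1 x), hF₀c q.2 q.1⟩
            (((π q.2 ⟨fun x => F₀ q.2 (q.1 x), hF₀c q.2 q.1⟩)⁻¹ * q.1) x)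
          refine h.symm.trans ?_
          simp, hcls _ q.2 (hF₀c q.2 q.1)⟩⟩
      left_inv := by
        rintro ⟨g, F, hg, hF⟩
        have h1 : (fun x => F₀ (toM F hF) ((π (toM F hF) ⟨F, rfl⟩ * g) x)) = F := by
          funext x
          rw [Equiv.Perm.mul_apply, hπ]
          exact hg x
        have h2 : π (toM F hF) ⟨fun x => F₀ (toM F hF) ((π (toM F hF) ⟨F, rfl⟩ * g) x),
            hF₀c _ _⟩ = π (toM F hF) ⟨F, rfl⟩ := by
          congr 2
        refine Sigma.subtype_ext ?_ h1
        change (π (toM F hF) ⟨fun x => F₀ (toM F hF) ((π (toM F hF) ⟨F, rfl⟩ * g) x),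
            hF₀c _ _⟩)⁻¹ * (π (toM F hF) ⟨F, rfl⟩ * g) = g
        rw [h2, inv_mul_cancel_left]
      right_inv := by
        rintro ⟨h, M⟩
        have h1 : toM (fun x => F₀ M (h x)) (hcls _ M (hF₀c M h)) = M := Subtype.ext (hF₀c M h)
        refine Prod.ext ?_ h1
        change π (toM (fun x => F₀ M (h x)) (hcls _ M (hF₀c M h))) ⟨fun x => F₀ M (h x), rfl⟩ *
          ((π M ⟨fun x => F₀ M (h x), hF₀c M h⟩)⁻¹ * h) = h
        have h2 : ∀ (M' : Contingency a m) (hM' : M' = M) (hc : jointContent _ = M'.1),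
            π M' ⟨fun x => F₀ M (h x), hc⟩ = π M ⟨fun x => F₀ M (h x), hF₀c M h⟩ := by
          rintro M' rfl hc
          rfl
        rw [h2 _ h1, mul_inv_cancel_left] }
  rw [← Nat.card_sigma, Nat.card_congr e, Nat.card_prod, Nat.card_eq_fintype_card,
    Fintype.card_perm]

theorem sum_shiftedParts (lam : YoungDiagram) (s : Equiv.Perm (Fin (lam.colLen 0))) :
    ∑ i, shiftedParts lam s i = lam.card := by
  simp only [shiftedParts]
  rw [Finset.sum_add_distrib, Finset.sum_sub_distrib,
    Equiv.sum_comp s fun i : Fin (lam.colLen 0) => ((i : ℕ) : ℤ), sub_add_cancel,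
    card_eq_sum_rowLen (rowLen_colLen lam), Finset.sum_range]
  push_cast
  rfl

/-- The Frobenius formula: a Schur function in terms of power sums. -/
theorem factorial_smul_schur [DecidableEq X] (lam : YoungDiagram)
    (hX : Fintype.card X = lam.card) :
    (lam.card.factorial : ℤ) • schur lam = ∑ g : Equiv.Perm X, chi lam g • fixSeries g := by
  ext m
  rw [map_zsmul, smul_eq_mul, coeff_schur, Finset.mul_sum, map_sum]
  simp only [map_zsmul, smul_eq_mul, chi, Finset.sum_mul]
  rw [Finset.sum_comm]
  refine Finset.sum_congr rfl fun s _ => ?_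
  have h := sum_card_fixedPairs (X := X) (shiftedParts lam s) m (by rw [sum_shiftedParts, hX])
  rw [hX] at h
  rw [mul_left_comm, ← Nat.cast_mul, ← h, Nat.cast_sum, Finset.mul_sum]
  refine Finset.sum_congr rfl fun g _ => ?_
  rw [← Nat.card_congr (fixedPairsEquiv _ m g), Nat.card_prod, Nat.cast_mul, coeff_fixSeries,
    mul_assoc]
  rfl

end PowerSums

/-! ### Triangularity -/

section Triangularity

/-- The rearrangement inequality, `f` and `i` being oppositely ordered. Indicators of initial
segments for `f` give dominance; the row lengths give the comparison of sums of squares. -/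
theorem sum_mul_rowLen_le (mu : YoungDiagram) (s : Equiv.Perm (Fin (mu.colLen 0)))
    {f : Fin (mu.colLen 0) → ℤ} (hf : Antitone f) :
    ∑ i, f i * mu.rowLen i ≤ ∑ i, f i * shiftedParts mu s i := by
  have h : Antivary f fun i : Fin (mu.colLen 0) => ((i : ℕ) : ℤ) := fun i j hij =>
    hf (by simpa using hij.le)
  have h1 := h.sum_mul_le_sum_mul_comp_perm (σ := s)
  have h2 : ∑ i, f i * shiftedParts mu s i = ∑ i, f i * mu.rowLen i +
      (∑ i, f i * ((s i : ℕ) : ℤ) - ∑ i, f i * ((i : ℕ) : ℤ)) := by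
    rw [← Finset.sum_sub_distrib, ← Finset.sum_add_distrib]
    exact Finset.sum_congr rfl fun i _ => by rw [shiftedParts]; ring
  rw [h2]
  linarith

/-- With `a = r + δ` and `δ = s i - i`, one has `a² = 2ra - r² + δ²`. The rearrangement inequality
bounds `∑ ra` from below by `∑ r²`, and `∑ δ² > 0` for `s ≠ 1`. -/
theorem sum_sq_rowLen_lt (mu : YoungDiagram) {s : Equiv.Perm (Fin (mu.colLen 0))} (hs : s ≠ 1) :
    ∑ i : Fin (mu.colLen 0), (mu.rowLen i : ℤ) ^ 2 < ∑ i, shiftedParts mu s i ^ 2 := by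
  have h1 := sum_mul_rowLen_le mu s (f := fun i => (mu.rowLen i : ℤ)) fun i j hij =>
    Int.ofNat_le.2 (mu.rowLen_anti i j hij)
  have h2 : ∑ i, shiftedParts mu s i ^ 2 = ∑ i : Fin (mu.colLen 0), (2 * ((mu.rowLen i : ℤ) * shiftedParts mu s i) -
      (mu.rowLen i : ℤ) * mu.rowLen i + (((s i : ℕ) : ℤ) - (i : ℕ)) ^ 2) :=
    Finset.sum_congr rfl fun i _ => by rw [shiftedParts]; ring
  have h3 : 0 < ∑ i, (((s i : ℕ) : ℤ) - (i : ℕ)) ^ 2 := by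
    obtain ⟨i, hi⟩ : ∃ i, s i ≠ i := by
      by_contra h
      push Not at h
      exact hs (Equiv.ext h)
    refine Finset.sum_pos' (fun i _ => sq_nonneg _) ⟨i, Finset.mem_univ i, ?_⟩
    refine (sq_nonneg _).lt_of_ne' (pow_ne_zero 2 ?_)
    have : (s i : ℕ) ≠ i := fun h => hi (Fin.ext h)
    omega
  have h4 : ∑ i : Fin (mu.colLen 0), (mu.rowLen i : ℤ) ^ 2 =
      ∑ i : Fin (mu.colLen 0), (mu.rowLen i : ℤ) * mu.rowLen i :=
    Finset.sum_congr rfl fun i _ => sq _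
  rw [h2, Finset.sum_add_distrib, Finset.sum_sub_distrib, ← Finset.mul_sum, h4]
  linarith

theorem sum_range_eq_sum_fin {L : ℕ} {e : ℕ → ℕ} (he : ∀ j, L ≤ j → e j = 0) (k : ℕ) :
    ∑ j ∈ Finset.range k, e j = ∑ i : Fin L, if (i : ℕ) < k then e i else 0 := by
  rw [← Finset.sum_range fun i => if i < k then e i else 0, ← Finset.sum_filter]
  refine (Finset.sum_subset (fun j hj => ?_) fun j hj hj' => he j ?_).symm
  · exact Finset.mem_range.2 (Finset.mem_filter.1 hj).2
  · by_contra h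
    exact hj' (Finset.mem_filter.2 ⟨Finset.mem_range.2 (not_le.1 h), Finset.mem_range.1 hj⟩)

theorem sum_range_rowLen_le {mu : YoungDiagram} {s : Equiv.Perm (Fin (mu.colLen 0))}
    (h : ∀ i, 0 ≤ shiftedParts mu s i) (k : ℕ) :
    ∑ j ∈ Finset.range k, mu.rowLen j ≤
      ∑ j ∈ Finset.range k, natExponent (shiftedParts mu s) j := by
  rw [sum_range_eq_sum_fin (fun j hj => rowLen_eq_zero_of_le (rowLen_colLen mu) hj),
    sum_range_eq_sum_fin fun j hj => natExponent_apply_of_le (shiftedParts mu s) hj]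
  have h1 := sum_mul_rowLen_le mu s (f := fun i => if (i : ℕ) < k then 1 else 0) fun i j hij => by
    have : (i : ℕ) ≤ j := hij
    simp only
    split_ifs <;> omega
  rw [← Nat.cast_le (α := ℤ), Nat.cast_sum, Nat.cast_sum]
  refine le_trans (le_of_eq ?_) (h1.trans (le_of_eq ?_))
  · exact Finset.sum_congr rfl fun i _ => by split_ifs <;> simp
  · refine Finset.sum_congr rfl fun i _ => ?_
    rw [natExponent_apply]
    split_ifs
    · simp [h i]
    · simp

theorem degree_natExponent {l : ℕ} {a : Fin l → ℤ} (h : ∀ i, 0 ≤ a i) :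
    ((natExponent a).degree : ℤ) = ∑ i, a i := by
  rw [natExponent, map_sum]
  push_cast
  exact Finset.sum_congr rfl fun i _ => by simp [h i]

theorem intCoeff_ne_zero {l : ℕ} {a : Fin l → ℤ} {F : MvPowerSeries ℕ ℤ} (h : intCoeff a F ≠ 0) :
    (∀ i, 0 ≤ a i) ∧ MvPowerSeries.coeff (natExponent a) F ≠ 0 := by
  have ha : ∀ i, 0 ≤ a i := fun i => by
    by_contra hi
    exact h (intCoeff_of_neg (not_le.1 hi) F)
  exact ⟨ha, by rwa [intCoeff_of_nonneg ha] at h⟩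

/-- If `mu` occurs in `F`, some monomial of `F` has degree `|mu|` and dominates `mu`. -/
theorem exists_of_schurCoord_ne_zero {mu : YoungDiagram} {F : MvPowerSeries ℕ ℤ}
    (h : schurCoord mu F ≠ 0) : ∃ m : ℕ →₀ ℕ, MvPowerSeries.coeff m F ≠ 0 ∧ m.degree = mu.card ∧
      ∀ k, ∑ j ∈ Finset.range k, mu.rowLen j ≤ ∑ j ∈ Finset.range k, m j := by
  rw [schurCoord_apply] at h
  obtain ⟨s, -, hs⟩ := Finset.exists_ne_zero_of_sum_ne_zero h
  obtain ⟨h1, h2⟩ := intCoeff_ne_zero (right_ne_zero_of_mul hs)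
  refine ⟨_, h2, ?_, sum_range_rowLen_le h1⟩
  have := degree_natExponent h1
  rw [sum_shiftedParts] at this
  exact_mod_cast this

theorem le_tableau {lam : YoungDiagram} (T : SemistandardYoungTableau lam) {i j : ℕ}
    (h : (i, j) ∈ lam) : i ≤ T i j := by
  induction i with
  | zero => exact Nat.zero_le _
  | succ i ih =>
    have h1 := ih (lam.up_left_mem (Nat.le_succ i) le_rfl h)
    have h2 := T.col_strict (Nat.lt_succ_self i) h
    exact Nat.succ_le_of_lt (h1.trans_lt h2)

theorem sum_range_tableauWeight {lam : YoungDiagram} (T : SemistandardYoungTableau lam) (k : ℕ) :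
    ∑ j ∈ Finset.range k, tableauWeight T j =
      (lam.cells.filter fun c => T c.1 c.2 < k).card := by
  rw [Finset.card_eq_sum_card_fiberwise (f := fun c => T c.1 c.2) (t := Finset.range k)]
  · refine Finset.sum_congr rfl fun j hj => ?_
    rw [tableauWeight_apply, Finset.filter_filter]
    congr 1
    ext c
    simp only [Finset.mem_filter]
    have := Finset.mem_range.1 hj
    constructor
    · rintro ⟨h, h'⟩; exact ⟨h, h' ▸ this, h'⟩
    · rintro ⟨h, -, h'⟩; exact ⟨h, h'⟩
  · intro c hc
    simpa using (Finset.mem_filter.1 hc).2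

theorem filter_tableau_subset {lam : YoungDiagram} (T : SemistandardYoungTableau lam) (k : ℕ) :
    (lam.cells.filter fun c => T c.1 c.2 < k) ⊆ lam.cells.filter fun c => c.1 < k := by
  intro c hc
  rw [Finset.mem_filter] at hc ⊢
  exact ⟨hc.1, (le_tableau T ((YoungDiagram.mem_cells _).1 hc.1)).trans_lt hc.2⟩

theorem exists_tableau_of_coeff_schur_ne_zero {lam : YoungDiagram} {m : ℕ →₀ ℕ}
    (h : MvPowerSeries.coeff m (schur lam) ≠ 0) :
    ∃ T : SemistandardYoungTableau lam, tableauWeight T = m := by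
  rw [schur_eq_weightSeries, coeff_weightSeries] at h
  by_contra hn
  have : IsEmpty {T : SemistandardYoungTableau lam // tableauWeight T = m} :=
    ⟨fun T => hn ⟨T.1, T.2⟩⟩
  exact h (by rw [Nat.card_of_isEmpty, Nat.cast_zero])

theorem degree_tableauWeight {lam : YoungDiagram} (T : SemistandardYoungTableau lam) :
    (tableauWeight T).degree = lam.card := by
  rw [tableauWeight, map_sum]
  simp [YoungDiagram.card]

theorem degree_eq_of_coeff_schur_ne_zero {lam : YoungDiagram} {m : ℕ →₀ ℕ}
    (h : MvPowerSeries.coeff m (schur lam) ≠ 0) : m.degree = lam.card := by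
  obtain ⟨T, rfl⟩ := exists_tableau_of_coeff_schur_ne_zero h
  exact degree_tableauWeight T

theorem sum_range_le_of_coeff_schur_ne_zero {lam : YoungDiagram} {m : ℕ →₀ ℕ}
    (h : MvPowerSeries.coeff m (schur lam) ≠ 0) (k : ℕ) :
    ∑ j ∈ Finset.range k, m j ≤ ∑ j ∈ Finset.range k, lam.rowLen j := by
  obtain ⟨T, rfl⟩ := exists_tableau_of_coeff_schur_ne_zero h
  rw [sum_range_tableauWeight, ← card_filter_row_lt]
  exact Finset.card_le_card (filter_tableau_subset T k)

/-- The exponent with entries the parts of `lam`. -/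
def rowExponent (lam : YoungDiagram) : ℕ →₀ ℕ := natExponent (shiftedParts lam 1)

theorem shiftedParts_one (lam : YoungDiagram) (i : Fin (lam.colLen 0)) :
    shiftedParts lam 1 i = lam.rowLen i := by
  simp [shiftedParts]

theorem rowExponent_apply (lam : YoungDiagram) (j : ℕ) : rowExponent lam j = lam.rowLen j := by
  by_cases hj : j < lam.colLen 0
  · have := natExponent_apply (shiftedParts lam 1) ⟨j, hj⟩
    rw [shiftedParts_one, Int.toNat_natCast] at this
    exact this
  · rw [rowExponent, natExponent_apply_of_le _ (not_lt.1 hj),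
      rowLen_eq_zero_of_le (rowLen_colLen lam) (not_lt.1 hj)]

/-- An entry of row `i` is at least `i`, so the cells with entry below `k` lie in the first `k`
rows. For the weight `lam` the counts agree, the inclusions are equalities, and only the highest
weight tableau remains. -/
theorem coeff_rowExponent_schur (lam : YoungDiagram) :
    MvPowerSeries.coeff (rowExponent lam) (schur lam) = 1 := by
  rw [schur_eq_weightSeries, coeff_weightSeries]
  have key (T : SemistandardYoungTableau lam) (hT : tableauWeight T = rowExponent lam) (i j : ℕ)
      (h : (i, j) ∈ lam) : T i j = i := by
    have h1 (k : ℕ) : (lam.cells.filter fun c => T c.1 c.2 < k) =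
        lam.cells.filter fun c => c.1 < k := by
      refine Finset.eq_of_subset_of_card_le (filter_tableau_subset T k) ?_
      rw [← sum_range_tableauWeight, card_filter_row_lt, hT]
      simp only [rowExponent_apply, le_refl]
    have h2 : (i, j) ∈ lam.cells.filter fun c => c.1 < i + 1 :=
      Finset.mem_filter.2 ⟨(YoungDiagram.mem_cells _).2 h, Nat.lt_succ_self i⟩
    rw [← h1, Finset.mem_filter] at h2
    have := le_tableau T h
    have := h2.2
    simp only at this
    omega
  have hw : tableauWeight (SemistandardYoungTableau.highestWeight lam) = rowExponent lam := by
    ext k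
    rw [tableauWeight_apply, rowExponent_apply, YoungDiagram.rowLen_eq_card, YoungDiagram.row]
    congr 1
    refine Finset.filter_congr fun c hc => ?_
    rw [SemistandardYoungTableau.highestWeight_apply, if_pos ((YoungDiagram.mem_cells _).1 hc)]
  have : Unique {T : SemistandardYoungTableau lam // tableauWeight T = rowExponent lam} :=
    ⟨⟨⟨_, hw⟩⟩, fun T => Subtype.ext (SemistandardYoungTableau.ext fun i j => by
      by_cases h : (i, j) ∈ lam
      · rw [key T.1 T.2 i j h]
        exact (if_pos h).symm
      · rw [T.1.zeros h]
        exact (if_neg h).symm)⟩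
  rw [Nat.card_unique, Nat.cast_one]

theorem rowLen_eq_of_sum_range_eq {f g : ℕ → ℕ}
    (h : ∀ k, ∑ j ∈ Finset.range k, f j = ∑ j ∈ Finset.range k, g j) (j : ℕ) : f j = g j := by
  have h1 := h (j + 1)
  rw [Finset.sum_range_succ, Finset.sum_range_succ, h j] at h1
  omega

/-- A contributing exponent dominates `lam`, and as an exponent of `s_lam` it is also dominated by
`lam`. Hence it equals `lam`, which forces `s = 1`. -/
theorem schurCoord_schur_self (lam : YoungDiagram) : schurCoord lam (schur lam) = 1 := by
  rw [schurCoord_apply, Finset.sum_eq_single 1]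
  · rw [intCoeff_of_nonneg (fun i => by rw [shiftedParts_one]; omega)]
    rw [← rowExponent, coeff_rowExponent_schur]
    simp
  · intro s _ hs
    by_contra h
    obtain ⟨h1, h2⟩ := intCoeff_ne_zero (right_ne_zero_of_mul h)
    have h3 := rowLen_eq_of_sum_range_eq fun k =>
      (sum_range_rowLen_le h1 k).antisymm (sum_range_le_of_coeff_schur_ne_zero h2 k)
    refine hs (Equiv.ext fun i => Fin.ext ?_)
    have h4 := h3 i
    rw [natExponent_apply] at h4
    have h5 := h1 i
    have h6 : shiftedParts lam s i = lam.rowLen i := by omega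
    rw [shiftedParts] at h6
    simp only [Equiv.Perm.coe_one, id_eq]
    omega
  · simp

/-- By the Frobenius formula, `n!` times either side is `∑ χ^lam(g) χ^mu(g)`. -/
theorem schurCoord_schur_comm {lam mu : YoungDiagram} (h : lam.card = mu.card) :
    schurCoord mu (schur lam) = schurCoord lam (schur mu) := by
  have key (lam mu : YoungDiagram) (h : lam.card = mu.card) :
      (lam.card.factorial : ℤ) * schurCoord mu (schur lam) =
        ∑ g : Equiv.Perm (Fin lam.card), chi lam g * chi mu g := by
    rw [← smul_eq_mul, ← map_zsmul,
      factorial_smul_schur (X := Fin lam.card) lam (Fintype.card_fin _), map_sum]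
    exact Finset.sum_congr rfl fun g _ => by rw [map_zsmul, smul_eq_mul, ← chi_eq_schurCoord]
  have h1 := key lam mu h
  have h2 := key mu lam h.symm
  rw [← h] at h2
  have h3 : ((lam.card.factorial : ℕ) : ℤ) ≠ 0 := by exact_mod_cast Nat.factorial_ne_zero _
  refine mul_left_cancel₀ h3 (h1.trans (Eq.trans ?_ h2.symm))
  exact Finset.sum_congr rfl fun g _ => mul_comm _ _

/-- A nonzero coordinate gives `mu ⊴ lam`; by symmetry it also gives `lam ⊴ mu`. -/
theorem schurCoord_schur_of_ne {lam mu : YoungDiagram} (hne : lam ≠ mu) :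
    schurCoord mu (schur lam) = 0 := by
  by_contra h
  obtain ⟨m, hm1, hm2, hm3⟩ := exists_of_schurCoord_ne_zero h
  have hc : lam.card = mu.card := (degree_eq_of_coeff_schur_ne_zero hm1).symm.trans hm2
  rw [schurCoord_schur_comm hc] at h
  obtain ⟨m', hm1', hm2', hm3'⟩ := exists_of_schurCoord_ne_zero h
  refine hne (youngDiagram_ext (rowLen_eq_of_sum_range_eq fun k => le_antisymm ?_ ?_))
  · exact (hm3' k).trans (sum_range_le_of_coeff_schur_ne_zero hm1' k)
  · exact (hm3 k).trans (sum_range_le_of_coeff_schur_ne_zero hm1 k)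

theorem schurCoord_sum (c : YoungDiagram →₀ ℤ) (mu : YoungDiagram) :
    schurCoord mu (c.sum fun nu a => a • schur nu) = c mu := by
  rw [Finsupp.sum, map_sum, Finset.sum_eq_single mu]
  · rw [map_zsmul, schurCoord_schur_self, smul_eq_mul, mul_one]
  · intro nu _ hnu
    rw [map_zsmul, schurCoord_schur_of_ne hnu, smul_zero]
  · intro hmu
    rw [Finsupp.notMem_support_iff.1 hmu, zero_smul, map_zero]

end Triangularity

/-! ### Expansion of symmetric functions in Schur functions -/

section Expansion

/-- Invariance of the coefficients under permutations of the variables. -/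
def IsSymm (F : MvPowerSeries ℕ ℤ) : Prop :=
  ∀ (τ : Equiv.Perm ℕ) (m : ℕ →₀ ℕ),
    MvPowerSeries.coeff (m.equivMapDomain τ) F = MvPowerSeries.coeff m F

theorem IsSymm.sum_zsmul {ι : Type*} (t : Finset ι) (a : ι → ℤ) {F : ι → MvPowerSeries ℕ ℤ}
    (h : ∀ i ∈ t, IsSymm (F i)) : IsSymm (∑ i ∈ t, a i • F i) := fun τ m => by
  rw [map_sum, map_sum]
  exact Finset.sum_congr rfl fun i hi => by rw [map_zsmul, map_zsmul, h i hi]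

theorem IsSymm.of_zsmul {a : ℤ} (ha : a ≠ 0) {F : MvPowerSeries ℕ ℤ} (h : IsSymm (a • F)) :
    IsSymm F := fun τ m => by
  have := h τ m
  rw [map_zsmul, map_zsmul, smul_eq_mul, smul_eq_mul] at this
  exact mul_left_cancel₀ ha this

theorem isSymm_fixSeries {X : Type*} [Fintype X] (g : Equiv.Perm X) : IsSymm (fixSeries g) :=
  coeff_fixSeries_equivMapDomain g

/-- Symmetry, hidden in the tableau definition, is visible on power sums, and `ℤ` has no torsion. -/
theorem isSymm_schur (lam : YoungDiagram) : IsSymm (schur lam) := by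
  have h3 : ((lam.card.factorial : ℕ) : ℤ) ≠ 0 := by exact_mod_cast Nat.factorial_ne_zero _
  refine IsSymm.of_zsmul h3 ?_
  rw [factorial_smul_schur (X := Fin lam.card) lam (Fintype.card_fin _)]
  exact IsSymm.sum_zsmul _ _ fun g _ => isSymm_fixSeries g

/-- Every exponent can be sorted to a partition. -/
theorem exists_rowExponent_eq (m : ℕ →₀ ℕ) :
    ∃ (mu : YoungDiagram) (τ : Equiv.Perm ℕ), m.equivMapDomain τ = rowExponent mu := by
  obtain ⟨L, hL⟩ : ∃ L, ∀ j, L ≤ j → m j = 0 := by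
    refine ⟨m.support.sup id + 1, fun j hj => ?_⟩
    by_contra h
    have : id j ≤ m.support.sup id := Finset.le_sup (Finsupp.mem_support_iff.2 h)
    simp only [id] at this
    omega
  -- The order dual makes `Tuple.sort` sort decreasingly.
  let f : Fin L → ℕᵒᵈ := fun i => OrderDual.toDual (m i)
  let τ : Equiv.Perm ℕ := (Tuple.sort f).extendDomain Fin.equivSubtype
  have hτ (j : ℕ) (hj : j < L) : τ j = Tuple.sort f ⟨j, hj⟩ := by
    refine (Equiv.Perm.extendDomain_apply_subtype _ _ (p := (· < L)) hj).trans ?_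
    rfl
  have hτ' (j : ℕ) (hj : L ≤ j) : τ j = j :=
    Equiv.Perm.extendDomain_apply_not_subtype _ _ (not_lt.2 hj)
  have hb : Antitone fun j => m (τ j) := by
    intro i j hij
    by_cases hj : j < L
    · have hi := hij.trans_lt hj
      have := Tuple.monotone_sort f (show (⟨i, hi⟩ : Fin L) ≤ ⟨j, hj⟩ from hij)
      simp only [hτ i hi, hτ j hj]
      exact this
    · simp only [hτ' j (not_lt.1 hj), hL j (not_lt.1 hj)]
      exact Nat.zero_le _
  refine ⟨diagramOfRows _ hb L, τ.symm, Finsupp.ext fun j => ?_⟩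
  rw [Finsupp.equivMapDomain_apply, rowExponent_apply, rowLen_diagramOfRows]
  · simp
  · rw [hτ' L le_rfl, hL L le_rfl]

/-- The sum of the squares of the entries of an exponent. -/
def sqSum (m : ℕ →₀ ℕ) : ℕ := m.sum fun _ a => a ^ 2

theorem sqSum_equivMapDomain (m : ℕ →₀ ℕ) (τ : Equiv.Perm ℕ) :
    sqSum (m.equivMapDomain τ) = sqSum m := by
  rw [Finsupp.equivMapDomain_eq_mapDomain, sqSum, Finsupp.sum_mapDomain_index_inj τ.injective]
  rfl

theorem sqSum_le (m : ℕ →₀ ℕ) : sqSum m ≤ m.degree ^ 2 :=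
  Finset.sum_sq_le_sq_sum_of_nonneg fun _ _ => Nat.zero_le _

theorem sqSum_natExponent {l : ℕ} {a : Fin l → ℤ} (h : ∀ i, 0 ≤ a i) :
    (sqSum (natExponent a) : ℤ) = ∑ i, a i ^ 2 := by
  have h1 : sqSum (natExponent a) = ∑ j ∈ Finset.range l, natExponent a j ^ 2 := by
    refine Finsupp.sum_of_support_subset _ (fun j hj => ?_) _ fun _ _ => by simp
    rw [Finset.mem_range]
    by_contra hl
    exact Finsupp.mem_support_iff.1 hj (natExponent_apply_of_le a (not_lt.1 hl))
  rw [h1, Finset.sum_range]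
  push_cast
  exact Finset.sum_congr rfl fun i _ => by rw [natExponent_apply, Int.toNat_of_nonneg (h i)]

/-- A homogeneous symmetric function without Schur coordinates vanishes. -/
theorem eq_zero_of_schurCoord_eq_zero {n : ℕ} {G : MvPowerSeries ℕ ℤ} (hsymm : IsSymm G)
    (hdeg : ∀ m, MvPowerSeries.coeff m G ≠ 0 → m.degree = n) (h0 : ∀ mu, schurCoord mu G = 0) :
    G = 0 := by
  -- Downward induction on the sum of squares, which is at most `n²` in degree `n`. After sorting
  -- `m` to a partition `mu`, the functional `schurCoord mu` is the coefficient at `m` plus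
  -- coefficients at exponents with larger sum of squares, which vanish already.
  have key : ∀ (d : ℕ) (m : ℕ →₀ ℕ), n ^ 2 - sqSum m = d → MvPowerSeries.coeff m G = 0 := by
    intro d
    induction d using Nat.strong_induction_on with
    | _ d ih =>
    intro m hd
    obtain ⟨mu, τ, hmu⟩ := exists_rowExponent_eq m
    rw [← hsymm τ m, hmu]
    have h1 := h0 mu
    rw [schurCoord_apply, Finset.sum_eq_single 1] at h1
    · rw [intCoeff_of_nonneg (fun i => by rw [shiftedParts_one]; omega)] at h1
      simpa [rowExponent] using h1
    · intro s _ hs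
      by_contra h
      obtain ⟨h2, h3⟩ := intCoeff_ne_zero (right_ne_zero_of_mul h)
      have h4 := sum_sq_rowLen_lt mu hs
      rw [← sqSum_natExponent h2] at h4
      have h5 : (sqSum m : ℤ) = ∑ i : Fin (mu.colLen 0), (mu.rowLen i : ℤ) ^ 2 := by
        rw [← sqSum_equivMapDomain m τ, hmu, rowExponent, sqSum_natExponent
          (fun i => by rw [shiftedParts_one]; omega)]
        simp only [shiftedParts_one]
      rw [← h5] at h4
      have h6 := sqSum_le (natExponent (shiftedParts mu s))
      rw [hdeg _ h3] at h6
      exact h3 (ih _ (by omega) _ rfl)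
    · simp
  ext m
  rw [key _ m rfl, map_zero]

theorem finite_card_eq (n : ℕ) : {mu : YoungDiagram | mu.card = n}.Finite := by
  refine Set.Finite.of_finite_image (f := YoungDiagram.cells)
    ((Finset.finite_toSet (Finset.range n ×ˢ Finset.range n).powerset).subset ?_)
    fun mu _ nu _ h => YoungDiagram.ext h
  rintro _ ⟨mu, hmu, rfl⟩
  rw [Finset.mem_coe, Finset.mem_powerset]
  rintro ⟨i, j⟩ h
  rw [YoungDiagram.mem_cells] at h
  have hmu : mu.card = n := hmu
  have hi : i < mu.colLen 0 :=
    YoungDiagram.mem_iff_lt_colLen.1 (mu.up_left_mem le_rfl (Nat.zero_le j) h)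
  have hj : j < mu.rowLen 0 :=
    YoungDiagram.mem_iff_lt_rowLen.1 (mu.up_left_mem (Nat.zero_le i) le_rfl h)
  have h1 : mu.colLen 0 ≤ mu.card := by
    rw [YoungDiagram.colLen_eq_card]
    exact Finset.card_le_card (Finset.filter_subset _ _)
  have h2 : mu.rowLen 0 ≤ mu.card := by
    rw [YoungDiagram.rowLen_eq_card]
    exact Finset.card_le_card (Finset.filter_subset _ _)
  rw [Finset.mem_product, Finset.mem_range, Finset.mem_range]
  exact ⟨by omega, by omega⟩

/-- The Schur coordinates of a homogeneous power series. -/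
def schurCoords (F : MvPowerSeries ℕ ℤ) {n : ℕ}
    (hdeg : ∀ m, MvPowerSeries.coeff m F ≠ 0 → m.degree = n) : YoungDiagram →₀ ℤ :=
  Finsupp.ofSupportFinite (fun mu => schurCoord mu F) ((finite_card_eq n).subset fun mu hmu => by
    obtain ⟨m, h1, h2, -⟩ := exists_of_schurCoord_ne_zero hmu
    exact h2.symm.trans (hdeg m h1))

/-- A homogeneous symmetric function is the combination of Schur functions given by its
coordinates. -/
theorem eq_sum_schurCoords {F : MvPowerSeries ℕ ℤ} (hsymm : IsSymm F) {n : ℕ}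
    (hdeg : ∀ m, MvPowerSeries.coeff m F ≠ 0 → m.degree = n) :
    F = (schurCoords F hdeg).sum fun mu a => a • schur mu := by
  refine sub_eq_zero.1 (eq_zero_of_schurCoord_eq_zero (n := n) ?_ ?_ fun mu => ?_)
  · intro τ m
    rw [map_sub, map_sub, hsymm]
    congr 1
    exact IsSymm.sum_zsmul _ _ (fun mu _ => isSymm_schur mu) τ m
  · intro m hm
    by_contra hn
    refine hm ?_
    rw [map_sub, by_contra fun h => hn (hdeg m h), zero_sub, neg_eq_zero, Finsupp.sum, map_sum]
    refine Finset.sum_eq_zero fun mu hmu => ?_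
    rw [map_zsmul]
    refine smul_eq_zero_of_right _ (by_contra fun h => hn ?_)
    obtain ⟨m', h1, h2, -⟩ := exists_of_schurCoord_ne_zero (Finsupp.mem_support_iff.1 hmu)
    rw [degree_eq_of_coeff_schur_ne_zero h, ← h2, hdeg m' h1]
  · rw [map_sub, schurCoord_sum, sub_eq_zero]
    rfl

end Expansion

/-! ### Circular permutations of blocks -/

section Cycles

/-- For any choice of the other factors, the first one translates the product over all of `G`; so
each value is attained `|G|^(d-1)` times. -/
theorem sum_ofFn_prod {G R : Type*} [Group G] [Fintype G] [AddCommMonoid R] {d : ℕ} (hd : d ≠ 0)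
    (Φ : G → R) : ∑ w : Fin d → G, Φ (List.ofFn w).prod =
      Fintype.card G ^ (d - 1) • ∑ u, Φ u := by
  classical
  obtain ⟨n, rfl⟩ := Nat.exists_eq_succ_of_ne_zero hd
  rw [← Fintype.sum_equiv (Fin.consEquiv fun _ : Fin (n + 1) => G)
    (fun p => Φ (p.1 * (List.ofFn p.2).prod)) (fun w => Φ (List.ofFn w).prod) fun p => by
      simp [Fin.consEquiv, List.ofFn_succ], Fintype.sum_prod_type_right]
  have h (v : Fin n → G) : ∑ x, Φ (x * (List.ofFn v).prod) = ∑ u, Φ u :=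
    Fintype.sum_equiv (Equiv.mulRight (List.ofFn v).prod) _ _ fun _ => rfl
  simp only [h, Finset.sum_const, Finset.card_univ, Fintype.card_fun, Fintype.card_fin,
    Nat.succ_eq_add_one, add_tsub_cancel_right]

theorem partialProd_last {M : Type*} [Monoid M] {n : ℕ} (f : Fin n → M) :
    Fin.partialProd f (Fin.last n) = (List.ofFn f).prod := by
  rw [Fin.partialProd, List.take_of_length_le (by simp)]

/-- A family of maps which is fixed by a circular permutation of the factors amounts to one map
fixed by the product of the permutations. -/
theorem exists_cycle_equiv {Y : Type*} [Fintype Y] {d : ℕ} (hd : d ≠ 0)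
    (w : Fin d → Equiv.Perm Y) :
    ∃ e : {F : Fin d → Y → ℕ // ∀ j y, F j (w j y) = F (finRotate d j) y} ≃
        {f : Y → ℕ // ∀ y, f ((List.ofFn w).prod y) = f y},
      ∀ F j, content (F.1 j) = content (e F).1 := by
  obtain ⟨n, rfl⟩ := Nat.exists_eq_succ_of_ne_zero hd
  have hcast (j : Fin n) : finRotate (n + 1) j.castSucc = j.succ :=
    Fin.ext (coe_finRotate_of_ne_last (Fin.castSucc_lt_last j).ne)
  -- The relations say `F_{j+1} = F_j ∘ w_j`, so `F_j = F_0 ∘ w_0 ⋯ w_{j-1}`. The relation at the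
  -- last index closes the cycle and says that the full product fixes `F_0`.
  have hF (F : {F : Fin (n + 1) → Y → ℕ // ∀ j y, F j (w j y) = F (finRotate (n + 1) j) y})
      (j : Fin (n + 1)) (y : Y) : F.1 0 (Fin.partialProd w j.castSucc y) = F.1 j y := by
    induction j using Fin.induction generalizing y with
    | zero => simp
    | succ j ih =>
      rw [← Fin.succ_castSucc, Fin.partialProd_succ, Equiv.Perm.mul_apply, ih, F.2, hcast]
  refine ⟨
    { toFun := fun F => ⟨F.1 0, fun y => ?_⟩
      invFun := fun f => ⟨fun j y => f.1 (Fin.partialProd w j.castSucc y), fun j y => ?_⟩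
      left_inv := fun F => Subtype.ext (funext fun j => funext fun y => hF F j y)
      right_inv := fun f => Subtype.ext (funext fun y => by simp) }, fun F j => ?_⟩
  · rw [← partialProd_last, ← Fin.succ_last, Fin.partialProd_succ, Equiv.Perm.mul_apply, hF, F.2,
      finRotate_last]
  · change f.1 (Fin.partialProd w j.castSucc (w j y)) =
      f.1 (Fin.partialProd w (finRotate (n + 1) j).castSucc y)
    rw [← Equiv.Perm.mul_apply, ← Fin.partialProd_succ]
    induction j using Fin.lastCases with
    | last =>
      rw [Fin.succ_last, partialProd_last, f.2, finRotate_last]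
      simp
    | cast j => rw [hcast, Fin.succ_castSucc]
  · rw [← funext (hF F j)]
    exact content_comp (F.1 0) (Fin.partialProd w j.castSucc)

end Cycles

/-! ### The twisted product of Schur functions as a sum of power sums -/

namespace PType

variable (ω : PType)

/-- The permutation of the points given by `w ∈ ∏ (S_{|ω^i|})^{d_i}` followed after the circular
permutation of the blocks. -/
def circPerm (w : ω.Base) : Equiv.Perm ω.Point :=
  Equiv.Perm.sigmaCongrRightHom (fun b : ω.Block => Fin (ω.part b.1).card) w *
    ω.topPointHom ω.circ

theorem circPerm_apply (w : ω.Base) (i : Fin ω.r) (k : Fin (ω.deg i))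
    (y : Fin (ω.part i).card) : ω.circPerm w ⟨⟨i, k⟩, y⟩ =
      ⟨⟨i, (finRotate (ω.deg i)).symm k⟩, w ⟨i, (finRotate (ω.deg i)).symm k⟩ y⟩ := rfl

/-- The product of the components of `w` in the blocks with index `i`. -/
def cycleProd (w : ω.Base) (i : Fin ω.r) : Equiv.Perm (Fin (ω.part i).card) :=
  (List.ofFn fun k => w ⟨i, k⟩).prod

/-- Maps fixed by the circular permutation, sorted by the index of the blocks. -/
def fixedCurry (w : ω.Base) : {f : ω.Point → ℕ // ∀ x, f (ω.circPerm w x) = f x} ≃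
    ∀ i, {F : Fin (ω.deg i) → Fin (ω.part i).card → ℕ //
      ∀ j y, F j (w ⟨i, j⟩ y) = F (finRotate (ω.deg i) j) y} where
  toFun f i := ⟨fun k y => f.1 ⟨⟨i, k⟩, y⟩, fun j y => by
    have h := f.2 ⟨⟨i, finRotate (ω.deg i) j⟩, y⟩
    rw [circPerm_apply] at h
    have key : ∀ k, k = j → f.1 ⟨⟨i, k⟩, w ⟨i, k⟩ y⟩ = f.1 ⟨⟨i, j⟩, w ⟨i, j⟩ y⟩ := by
      rintro _ rfl
      rfl
    exact (key _ (Equiv.symm_apply_apply _ j)).symm.trans h⟩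
  invFun F := ⟨fun x => (F x.1.1).1 x.1.2 x.2, by
    rintro ⟨⟨i, k⟩, y⟩
    rw [circPerm_apply]
    have h := (F i).2 ((finRotate (ω.deg i)).symm k) y
    rw [Equiv.apply_symm_apply] at h
    exact h⟩
  left_inv _ := rfl
  right_inv _ := rfl

/-- On the blocks of index `i` a fixed map is a cycle of `d_i` maps, determined by one map fixed by
`cycleProd w i`. All of them have its content, so the weight is multiplied by `d_i`, which is the
substitution `x ↦ x^{d_i}`. -/
theorem fixSeries_circPerm (w : ω.Base) : fixSeries (ω.circPerm w) =
    ∏ i, MvPowerSeries.expand (ω.deg i) (ω.deg_ne i) (fixSeries (ω.cycleProd w i)) := by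
  have h := fun i => exists_cycle_equiv (Y := Fin (ω.part i).card) (ω.deg_ne i) fun k => w ⟨i, k⟩
  choose e he using h
  simp only [fixSeries, expand_weightSeries]
  rw [prod_weightSeries]
  · refine weightSeries_congr ((ω.fixedCurry w).trans (Equiv.piCongrRight e)) fun f => ?_
    rw [content, Fintype.sum_sigma, Fintype.sum_sigma]
    refine Finset.sum_congr rfl fun i _ => ?_
    have h1 (k : Fin (ω.deg i)) : ∑ y, Finsupp.single (f.1 ⟨⟨i, k⟩, y⟩) 1 =
        content (e i (ω.fixedCurry w f i)).1 := he i (ω.fixedCurry w f i) k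
    simp only [h1, Finset.sum_const, Finset.card_univ, Fintype.card_fin]
    rfl
  · intro i
    exact (finiteFibres_content.restrict _).smul (ω.deg_ne i)

theorem card_base : Fintype.card ω.Base = ∏ i, (ω.part i).card.factorial ^ ω.deg i := by
  rw [Fintype.card_pi, Fintype.prod_sigma]
  refine Finset.prod_congr rfl fun i _ => ?_
  simp [Fintype.card_perm]

/-- The Frobenius formula is applied to each factor; the sum over one permutation is then spread
over `d_i`-tuples with that product by `sum_ofFn_prod`. -/
theorem card_base_smul_schurProd : (Fintype.card ω.Base : ℤ) • ω.schurProd =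
    ∑ w : ω.Base, (∏ i, chi (ω.part i) (ω.cycleProd w i)) • fixSeries (ω.circPerm w) := by
  let Ψ (i : Fin ω.r) (u : Equiv.Perm (Fin (ω.part i).card)) : MvPowerSeries ℕ ℤ :=
    chi (ω.part i) u • MvPowerSeries.expand (ω.deg i) (ω.deg_ne i) (fixSeries u)
  have h1 (w : ω.Base) : (∏ i, chi (ω.part i) (ω.cycleProd w i)) • fixSeries (ω.circPerm w) =
      ∏ i, Ψ i (List.ofFn (Equiv.piCurry (fun i (_ : Fin (ω.deg i)) =>
        Equiv.Perm (Fin (ω.part i).card)) w i)).prod := by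
    rw [fixSeries_circPerm, ← Finset.prod_smul]
    rfl
  have h2 (i : Fin ω.r) : ∑ w : Fin (ω.deg i) → Equiv.Perm (Fin (ω.part i).card),
      Ψ i (List.ofFn w).prod = (((ω.part i).card.factorial ^ ω.deg i : ℕ) : ℤ) •
        MvPowerSeries.expand (ω.deg i) (ω.deg_ne i) (schur (ω.part i)) := by
    have h3 : ∑ u, Ψ i u = ((ω.part i).card.factorial : ℤ) •
        MvPowerSeries.expand (ω.deg i) (ω.deg_ne i) (schur (ω.part i)) := by
      rw [← map_zsmul, factorial_smul_schur (X := Fin (ω.part i).card) _ (Fintype.card_fin _),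
        map_sum]
      exact Finset.sum_congr rfl fun u _ => (map_zsmul _ _ _).symm
    rw [sum_ofFn_prod (ω.deg_ne i), h3, Fintype.card_perm, Fintype.card_fin, ← natCast_zsmul,
      smul_smul, ← Nat.cast_mul, pow_sub_one_mul (ω.deg_ne i)]
  rw [Finset.sum_congr rfl fun w _ => h1 w, Fintype.sum_equiv (Equiv.piCurry
      (fun i (_ : Fin (ω.deg i)) => Equiv.Perm (Fin (ω.part i).card))) _
      (fun w => ∏ i, Ψ i (List.ofFn (w i)).prod) fun _ => rfl, ← Fintype.piFinset_univ,
    ← Finset.prod_univ_sum (fun _ => Finset.univ) fun i w => Ψ i (List.ofFn w).prod,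
    Finset.prod_congr rfl fun i _ => h2 i, Finset.prod_smul, card_base, Nat.cast_prod]
  rfl

theorem isSymm_schurProd : IsSymm ω.schurProd := by
  have h : (Fintype.card ω.Base : ℤ) ≠ 0 := by exact_mod_cast Fintype.card_ne_zero
  refine IsSymm.of_zsmul h ?_
  rw [card_base_smul_schurProd]
  exact IsSymm.sum_zsmul _ _ fun w _ => isSymm_fixSeries _

theorem exists_tableaux_of_coeff_schurProd_ne_zero {m : ℕ →₀ ℕ}
    (h : MvPowerSeries.coeff m ω.schurProd ≠ 0) :
    ∃ T : ∀ i, SemistandardYoungTableau (ω.part i), ∑ i, ω.deg i • tableauWeight (T i) = m := by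
  simp only [schurProd, schur_eq_weightSeries, expand_weightSeries] at h
  rw [prod_weightSeries, coeff_weightSeries] at h
  · by_contra hn
    have : IsEmpty {T : ∀ i, SemistandardYoungTableau (ω.part i) //
      ∑ i, ω.deg i • tableauWeight (T i) = m} := ⟨fun T => hn ⟨T.1, T.2⟩⟩
    exact h (by rw [Nat.card_of_isEmpty, Nat.cast_zero])
  · intro i
    exact (finiteFibres_tableauWeight _).smul (ω.deg_ne i)

theorem degree_eq_of_coeff_schurProd_ne_zero (m : ℕ →₀ ℕ)
    (h : MvPowerSeries.coeff m ω.schurProd ≠ 0) : m.degree = ω.size := by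
  obtain ⟨T, rfl⟩ := ω.exists_tableaux_of_coeff_schurProd_ne_zero h
  rw [map_sum, size]
  refine Finset.sum_congr rfl fun i _ => ?_
  rw [map_nsmul, degree_tableauWeight, smul_eq_mul]

theorem sum_range_le_of_coeff_schurProd_ne_zero {m : ℕ →₀ ℕ}
    (h : MvPowerSeries.coeff m ω.schurProd ≠ 0) (k : ℕ) : ∑ j ∈ Finset.range k, m j ≤
      ∑ j ∈ Finset.range k, ∑ i, ω.deg i * (ω.part i).rowLen j := by
  obtain ⟨T, rfl⟩ := ω.exists_tableaux_of_coeff_schurProd_ne_zero h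
  simp only [Finsupp.finsetSum_apply, Finsupp.smul_apply, smul_eq_mul]
  rw [Finset.sum_comm, Finset.sum_comm (s := Finset.range k)]
  refine Finset.sum_le_sum fun i _ => ?_
  rw [← Finset.mul_sum, ← Finset.mul_sum]
  refine Nat.mul_le_mul_left _ ?_
  rw [sum_range_tableauWeight, ← card_filter_row_lt]
  exact Finset.card_le_card (filter_tableau_subset (T i) k)

/-- The twisted Littlewood–Richardson coefficients. -/
def twistedLR : YoungDiagram →₀ ℤ :=
  schurCoords ω.schurProd ω.degree_eq_of_coeff_schurProd_ne_zero

/-- If `s_mu` occurs, some monomial of the product dominates `mu`; every monomial of the product is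
itself dominated by `ω⁺`, tableau by tableau. -/
theorem isTwistedLR_twistedLR : ω.IsTwistedLR ω.twistedLR := by
  refine ⟨fun mu hmu => ?_, eq_sum_schurCoords ω.isSymm_schurProd _⟩
  obtain ⟨m, h1, h2, h3⟩ := exists_of_schurCoord_ne_zero hmu
  exact ⟨h2.symm.trans (ω.degree_eq_of_coeff_schurProd_ne_zero m h1), fun k =>
    (h3 k).trans (ω.sum_range_le_of_coeff_schurProd_ne_zero h1 k)⟩

theorem IsTwistedLR.eq_twistedLR {c : YoungDiagram →₀ ℤ} (h : ω.IsTwistedLR c) :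
    c = ω.twistedLR := by
  ext mu
  rw [← schurCoord_sum c mu, ← h.2]
  rfl

/-- The twisted Littlewood–Richardson coefficients in terms of characters. -/
theorem card_base_mul_twistedLR (mu : YoungDiagram) :
    (Fintype.card ω.Base : ℤ) * ω.twistedLR mu =
      ∑ w : ω.Base, (∏ i, chi (ω.part i) (ω.cycleProd w i)) * chi mu (ω.circPerm w) := by
  have h : ω.twistedLR mu = schurCoord mu ω.schurProd := rfl
  rw [h, ← smul_eq_mul, ← map_zsmul, card_base_smul_schurProd, map_sum]
  exact Finset.sum_congr rfl fun w _ => by rw [map_zsmul, smul_eq_mul, ← chi_eq_schurCoord]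

end PType

/-! ### Traces -/

section Trace

/-- Walks from `a` to `b` with intermediate vertices `f`: `Fin.cons` lists the sources of the steps,
`Fin.snoc` the targets. -/
theorem ofFn_prod_apply {I R : Type*} [Fintype I] [DecidableEq I] [CommRing R] {n : ℕ}
    (M : Fin (n + 1) → Matrix I I R) (a b : I) :
    (List.ofFn M).prod a b = ∑ f : Fin n → I,
      ∏ j, M j ((Fin.cons a f : Fin (n + 1) → I) j) ((Fin.snoc f b : Fin (n + 1) → I) j) := by
  induction n generalizing a with
  | zero => simp [Fin.snoc]
  | succ n ih =>
    rw [List.ofFn_succ, List.prod_cons, Matrix.mul_apply,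
      ← Fintype.sum_equiv (Fin.consEquiv fun _ : Fin (n + 1) => I)
        (fun p => ∏ j, M j ((Fin.cons a (Fin.cons p.1 p.2 : Fin (n + 1) → I) : Fin (n + 2) → I) j)
          ((Fin.snoc (Fin.cons p.1 p.2 : Fin (n + 1) → I) b : Fin (n + 2) → I) j)) _ fun _ => rfl,
      Fintype.sum_prod_type]
    refine Finset.sum_congr rfl fun c _ => ?_
    rw [ih, Finset.mul_sum]
    refine Finset.sum_congr rfl fun f _ => ?_
    rw [Fin.prod_univ_succ (n := n + 1), ← Fin.cons_snoc_eq_snoc_cons]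
    simp

/-- The trace of a product of matrices as a sum over closed walks. -/
theorem trace_ofFn_prod {I R : Type*} [Fintype I] [DecidableEq I] [CommRing R] {d : ℕ}
    (hd : d ≠ 0) (M : Fin d → Matrix I I R) :
    (List.ofFn M).prod.trace = ∑ f : Fin d → I, ∏ j, M j (f j) (f (finRotate d j)) := by
  obtain ⟨n, rfl⟩ := Nat.exists_eq_succ_of_ne_zero hd
  rw [← Fintype.sum_equiv (Fin.consEquiv fun _ : Fin (n + 1) => I)
    (fun p => ∏ j, M j ((Fin.cons p.1 p.2 : Fin (n + 1) → I) j)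
      ((Fin.cons p.1 p.2 : Fin (n + 1) → I) (finRotate (n + 1) j))) _ fun _ => rfl,
    Fintype.sum_prod_type, Matrix.trace]
  refine Finset.sum_congr rfl fun a _ => ?_
  rw [Matrix.diag_apply, ofFn_prod_apply]
  simp only [Fin.snoc_eq_cons_rotate]

/-- The trace of an operator on the invariants of a finite group. -/
theorem trace_eq_average {κ Γ N E U : Type*} [Field κ] [CharZero κ] [Group Γ] [Group N]
    [Fintype N] [AddCommGroup E] [Module κ E] [FiniteDimensional κ E] [AddCommGroup U] [Module κ U]
    (R : Representation κ Γ E) (i : N →* Γ) (j : U →ₗ[κ] E) (hj : Function.Injective j)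
    (hrange : ∀ x, (∃ u, j u = x) ↔ ∀ n, R (i n) x = x) (t : Γ) (T : U →ₗ[κ] U)
    (hT : ∀ u, j (T u) = R t (j u)) :
    LinearMap.trace κ U T =
      (Fintype.card N : κ)⁻¹ * ∑ n, LinearMap.trace κ E (R (t * i n)) := by
  have hN : (Fintype.card N : κ) ≠ 0 := by exact_mod_cast Fintype.card_ne_zero
  have : FiniteDimensional κ U := FiniteDimensional.of_injective j hj
  let avg : E →ₗ[κ] E := (Fintype.card N : κ)⁻¹ • ∑ n, R (i n)
  have havg (x : E) : avg x = (Fintype.card N : κ)⁻¹ • ∑ n, R (i n) x := by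
    simp [avg, LinearMap.sum_apply]
  have hmem (x : E) : avg x ∈ LinearMap.range j := by
    refine LinearMap.mem_range.2 ((hrange _).2 fun n => ?_)
    rw [havg, map_smul, map_sum]
    congr 1
    refine Fintype.sum_equiv (Equiv.mulLeft n) _ _ fun n' => ?_
    simp
  let π : E →ₗ[κ] U := (LinearEquiv.ofInjective j hj).symm.toLinearMap ∘ₗ
    avg.codRestrict (LinearMap.range j) hmem
  have hjπ (x : E) : j (π x) = avg x := by
    have := LinearEquiv.apply_symm_apply (LinearEquiv.ofInjective j hj)
      (avg.codRestrict (LinearMap.range j) hmem x)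
    exact congrArg Subtype.val this
  have hπj (u : U) : π (j u) = u := by
    apply hj
    rw [hjπ, havg, Finset.sum_congr rfl fun n _ => (hrange (j u)).1 ⟨u, rfl⟩ n, Finset.sum_const,
      Finset.card_univ, ← Nat.cast_smul_eq_nsmul κ, smul_smul, inv_mul_cancel₀ hN, one_smul]
  -- The averaging operator factors as `j ∘ π` with `π ∘ j = 1`, so cyclicity of the trace moves the
  -- computation from `U` to `E`.
  have h1 : T = (T ∘ₗ π) ∘ₗ j := LinearMap.ext fun u => by simp [hπj]
  have h2 : j ∘ₗ (T ∘ₗ π) = R t ∘ₗ avg := LinearMap.ext fun x => by simp [hT, hjπ]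
  rw [h1, LinearMap.trace_comp_comm', h2]
  have h3 : R t ∘ₗ avg = (Fintype.card N : κ)⁻¹ • ∑ n, R (t * i n) := LinearMap.ext fun x => by
    simp [havg, LinearMap.sum_apply]
  rw [h3, map_smul, map_sum, smul_eq_mul]

end Trace

/-! ### The trace of a twisted circular permutation of tensor factors -/

namespace PType

variable (ω : PType) {κ : Type*} [Field κ] {V : YoungDiagram → Type*}
  [∀ lam, AddCommGroup (V lam)] [∀ lam, Module κ (V lam)]
  (ρ : ∀ lam : YoungDiagram, Representation κ (Equiv.Perm (Fin lam.card)) (V lam))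

theorem extRep_inl (w : ω.Base) : ω.extRep ρ (SemidirectProduct.inl w) = ω.baseRep ρ w := by
  change ω.baseRep ρ _ * ω.topRep κ V 1 = _
  rw [map_one, mul_one]
  rfl

theorem extRep_inv_tprod (w : ω.Base) (x : ∀ b : ω.Block, V (ω.part b.1)) :
    ω.extRep ρ (SemidirectProduct.inl w * SemidirectProduct.inr ω.circ)⁻¹
        (PiTensorProduct.tprod κ x) =
      PiTensorProduct.tprod κ fun b : ω.Block => ρ (ω.part b.1)
        (w ⟨b.1, ω.circ b.1 b.2⟩)⁻¹ (x ⟨b.1, ω.circ b.1 b.2⟩) := by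
  have h : ω.extRep ρ (SemidirectProduct.inr ω.circ⁻¹) = ω.topRep κ V ω.circ⁻¹ := by
    change ω.baseRep ρ 1 * ω.topRep κ V _ = _
    rw [map_one, one_mul]
    rfl
  rw [mul_inv_rev, ← map_inv, ← map_inv, map_mul, extRep_inl, h, Module.End.mul_apply, baseRep_tprod]
  exact ω.topOp_tprod _ _

variable [∀ lam, FiniteDimensional κ (V lam)]

/-- Matrices of the contragredient representation. -/
def dualMatrixHom (lam : YoungDiagram) : Equiv.Perm (Fin lam.card) →*
    Matrix (Fin (Module.finrank κ (V lam))) (Fin (Module.finrank κ (V lam))) κ where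
  -- Inversion and transposition both reverse products; together they preserve the order of the
  -- factors in `cycleProd`.
  toFun g := (LinearMap.toMatrix (Module.finBasis κ (V lam)) (Module.finBasis κ (V lam))
    (ρ lam g⁻¹)).transpose
  map_one' := by
    rw [inv_one, map_one, LinearMap.toMatrix_one, Matrix.transpose_one]
  map_mul' g h := by
    rw [mul_inv_rev, map_mul, LinearMap.toMatrix_mul, Matrix.transpose_mul]

theorem trace_dualMatrixHom (lam : YoungDiagram) (g : Equiv.Perm (Fin lam.card)) :
    (dualMatrixHom ρ lam g).trace = (ρ lam).character g⁻¹ := by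
  change Matrix.trace (Matrix.transpose _) = _
  rw [Matrix.trace_transpose, Representation.character,
    LinearMap.trace_eq_matrix_trace κ (Module.finBasis κ (V lam))]

/-- In a tensor basis, each diagonal entry is a product of matrix entries joining the index at block
`k` to the index at the next block. Summing over all indices gives closed walks, hence for each `i`
the trace of a product of matrices. -/
theorem trace_extRep_inv (w : ω.Base) :
    LinearMap.trace κ (ω.VSpace κ V)
        (ω.extRep ρ (SemidirectProduct.inl w * SemidirectProduct.inr ω.circ)⁻¹) =
      ∏ i, (ρ (ω.part i)).character (ω.cycleProd w i)⁻¹ := by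
  classical
  let bs (b : ω.Block) := Module.finBasis κ (V (ω.part b.1))
  rw [LinearMap.trace_eq_matrix_trace κ (Basis.piTensorProduct bs), Matrix.trace]
  have h1 (f : ∀ b : ω.Block, Fin (Module.finrank κ (V (ω.part b.1)))) :
      Matrix.diag (LinearMap.toMatrix (Basis.piTensorProduct bs) (Basis.piTensorProduct bs)
        (ω.extRep ρ (SemidirectProduct.inl w * SemidirectProduct.inr ω.circ)⁻¹)) f =
      ∏ i, ∏ k, dualMatrixHom ρ (ω.part i) (w ⟨i, k⟩) (f ⟨i, k⟩)
        (f ⟨i, finRotate (ω.deg i) k⟩) := by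
    rw [Matrix.diag_apply, LinearMap.toMatrix_apply, Basis.piTensorProduct_apply,
      extRep_inv_tprod, Basis.piTensorProduct_repr_tprod_apply, Fintype.prod_sigma]
    refine Finset.prod_congr rfl fun i _ => ?_
    refine Fintype.prod_equiv (ω.circ i) _ _ fun k => ?_
    -- The block index is generalized so that `finRotate` of its inverse image can be replaced by
    -- `k` inside the dependent types.
    have key : ∀ k', k' = k → ∀ k'', (bs ⟨i, k⟩).repr (ρ (ω.part i) (w ⟨i, k''⟩)⁻¹
        (bs ⟨i, k''⟩ (f ⟨i, k''⟩))) (f ⟨i, k⟩) =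
        dualMatrixHom ρ (ω.part i) (w ⟨i, k''⟩) (f ⟨i, k''⟩) (f ⟨i, k'⟩) := by
      rintro _ rfl k''
      exact (LinearMap.toMatrix_apply _ _ _ _ _).symm
    exact key _ (Equiv.apply_symm_apply (finRotate (ω.deg i)) k) _
  have h2 (i : Fin ω.r) : (ρ (ω.part i)).character (ω.cycleProd w i)⁻¹ =
      ∑ f : Fin (ω.deg i) → Fin (Module.finrank κ (V (ω.part i))),
        ∏ k, dualMatrixHom ρ (ω.part i) (w ⟨i, k⟩) (f k) (f (finRotate (ω.deg i) k)) := by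
    rw [← trace_dualMatrixHom, cycleProd, map_list_prod, List.map_ofFn,
      trace_ofFn_prod (ω.deg_ne i)]
    rfl
  rw [Finset.sum_congr rfl fun f _ => h1 f, Finset.prod_congr rfl fun i _ => h2 i,
    Finset.prod_univ_sum, Fintype.piFinset_univ]
  exact Fintype.sum_equiv (Equiv.piCurry fun i (_ : Fin (ω.deg i)) =>
    Fin (Module.finrank κ (V (ω.part i)))) _ _ fun _ => rfl

end PType

namespace PType

/-! ### Frobenius reciprocity -/

section Frobenius

variable (ω : PType) {κ : Type*} [Field κ] {V : YoungDiagram → Type*}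
  [∀ lam, AddCommGroup (V lam)] [∀ lam, Module κ (V lam)]
  (ρ : ∀ lam : YoungDiagram, Representation κ (Equiv.Perm (Fin lam.card)) (V lam))
  {n : ℕ} (e : ω.Point ≃ Fin n) {M : Type*} [AddCommGroup M] [Module κ M]
  (τ : Representation κ (Equiv.Perm (Fin n)) M)

/-- Restriction of a homomorphism from `Ind_S^{S_n}(V_ω)` to `V_ω`. -/
def restrictHom : Representation.IntertwiningMap (ω.indRep ρ e) τ →ₗ[κ] ω.VSpace κ V →ₗ[κ] M where
  toFun f := f.toLinearMap ∘ₗ Representation.IndV.mk (ω.subgroupS e).subtype (ω.repS ρ e) 1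
  map_add' _ _ := rfl
  map_smul' _ _ := rfl

theorem restrictHom_apply (f : Representation.IntertwiningMap (ω.indRep ρ e) τ)
    (u : ω.VSpace κ V) : ω.restrictHom ρ e τ f u =
      f (Representation.IndV.mk (ω.subgroupS e).subtype (ω.repS ρ e) 1 u) := rfl

theorem apply_indV_mk (f : Representation.IntertwiningMap (ω.indRep ρ e) τ)
    (h : Equiv.Perm (Fin n)) (u : ω.VSpace κ V) :
    f (Representation.IndV.mk (ω.subgroupS e).subtype (ω.repS ρ e) h u) =
      τ h⁻¹ (ω.restrictHom ρ e τ f u) := by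
  rw [restrictHom_apply, ← f.isIntertwining, Representation.ind_mk, inv_inv, one_mul]

theorem restrictHom_injective : Function.Injective (ω.restrictHom ρ e τ) := by
  intro f f' h
  refine Representation.IntertwiningMap.ext (Representation.IndV.hom_ext _ _ fun y =>
    LinearMap.ext fun u => ?_)
  exact (ω.apply_indV_mk ρ e τ f y u).trans (by rw [h, ← apply_indV_mk]; rfl)

/-- Acting by `t⁻¹` moves the class of `1 ⊗ u` to that of `t⁻¹ ⊗ t⁻¹u`, and equivariance of `f`
converts the first factor into `τ(t)`. The action thus becomes conjugation on linear maps. -/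
theorem restrictHom_homRep (t : ω.Ext) (f : Representation.IntertwiningMap (ω.indRep ρ e) τ) :
    ω.restrictHom ρ e τ (ω.homRep ρ e τ t f) =
      Representation.linHom (ω.extRep ρ) (τ.comp (ω.extHom e)) t (ω.restrictHom ρ e τ f) := by
  refine LinearMap.ext fun u => ?_
  change f (ω.extInd ρ e t⁻¹ (Representation.IndV.mk _ _ 1 u)) =
    τ (ω.extHom e t) (ω.restrictHom ρ e τ f (ω.extRep ρ t⁻¹ u))
  rw [extInd_mk, mul_one, apply_indV_mk, map_inv (ω.extHom e), inv_inv]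

theorem extHom_inl (w : ω.Base) : ω.extHom e (SemidirectProduct.inl w) = ω.baseHom e w := by
  simp [extHom]

theorem repS_baseEquiv (w : ω.Base) : ω.repS ρ e (ω.baseEquiv e w) = ω.baseRep ρ w := by
  simp [repS]

theorem extInd_inl (w : ω.Base) : ω.extInd ρ e (SemidirectProduct.inl w) = 1 := by
  refine Representation.IndV.hom_ext _ _ fun y => LinearMap.ext fun u => ?_
  change ω.extInd ρ e _ (Representation.IndV.mk _ _ y u) = Representation.IndV.mk _ _ y u
  rw [extInd_mk, extHom_inl, extRep_inl, ← repS_baseEquiv ω ρ e]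
  have h := Representation.Coinvariants.mk_self_apply
    (Representation.tprod ((Representation.leftRegular κ (Equiv.Perm (Fin n))).comp
      (ω.subgroupS e).subtype) (ω.repS ρ e)) (ω.baseEquiv e w)
    (MonoidAlgebra.single y 1 ⊗ₜ[κ] u)
  rw [Representation.tprod_apply, TensorProduct.map_tmul] at h
  refine Eq.trans ?_ h
  change Representation.Coinvariants.mk _ (_ ⊗ₜ[κ] _) = _
  congr 2
  simp
  rfl

/-- Frobenius reciprocity in the form required by `trace_eq_average`. Restrictions are invariant
because `S` acts trivially on the coinvariants (`extInd_inl`); an invariant `φ` extends by `y ⊗ u ↦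
τ(y⁻¹) φ(u)`, which descends to the coinvariants by invariance. -/
theorem exists_restrictHom_eq_iff (φ : ω.VSpace κ V →ₗ[κ] M) :
    (∃ f, ω.restrictHom ρ e τ f = φ) ↔ ∀ w : ω.Base,
      Representation.linHom (ω.extRep ρ) (τ.comp (ω.extHom e)) (SemidirectProduct.inl w) φ = φ := by
  constructor
  · rintro ⟨f, rfl⟩ w
    rw [← restrictHom_homRep]
    congr 1
    refine Representation.IntertwiningMap.ext (LinearMap.ext fun z => ?_)
    change f (ω.extInd ρ e (SemidirectProduct.inl w)⁻¹ z) = f z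
    rw [← map_inv, extInd_inl]
    rfl
  · intro hφ
    have h1 (s : ω.subgroupS e) (u : ω.VSpace κ V) :
        τ (s : Equiv.Perm (Fin n))⁻¹ (φ (ω.repS ρ e s u)) = φ u := by
      obtain ⟨w, rfl⟩ := (ω.baseEquiv e).surjective s
      have h := LinearMap.congr_fun (hφ w⁻¹) u
      rw [Representation.linHom_apply, ← map_inv, inv_inv, extRep_inl] at h
      have hw : ((ω.baseEquiv e w : ω.subgroupS e) : Equiv.Perm (Fin n))⁻¹ =
          ω.extHom e (SemidirectProduct.inl w⁻¹) := by
        rw [extHom_inl]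
        exact (map_inv (ω.baseHom e) w).symm
      rw [repS_baseEquiv, hw]
      exact h
    let F : Representation.IndV (ω.subgroupS e).subtype (ω.repS ρ e) →ₗ[κ] M :=
      Representation.Coinvariants.lift _
        (TensorProduct.lift ((Finsupp.lift _ _ _ fun h => τ h⁻¹ ∘ₗ φ) ∘ₗ
          (MonoidAlgebra.coeffLinearEquiv κ).toLinearMap)) fun s => by
            ext y u
            have h2 (x : ω.VSpace κ V) : τ (s * y)⁻¹ (φ (ω.repS ρ e s x)) = τ y⁻¹ (φ x) := by
              rw [mul_inv_rev, map_mul, Module.End.mul_apply, h1]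
            simpa using h2 (PiTensorProduct.tprod κ u)
    have hF (y : Equiv.Perm (Fin n)) (u : ω.VSpace κ V) :
        F (Representation.IndV.mk _ _ y u) = τ y⁻¹ (φ u) := by
      simp [F]
    refine ⟨⟨F, fun g => Representation.IndV.hom_ext _ _ fun y => LinearMap.ext fun u => ?_⟩,
      LinearMap.ext fun u => ?_⟩
    · change F (ω.indRep ρ e g (Representation.IndV.mk _ _ y u)) =
        τ g (F (Representation.IndV.mk _ _ y u))
      rw [Representation.ind_mk, hF, hF, mul_inv_rev, inv_inv, map_mul]
      rfl
    · change F (Representation.IndV.mk _ _ 1 u) = φ u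
      rw [hF, inv_one, map_one]
      rfl

theorem trace_homRep [CharZero κ] [∀ lam, FiniteDimensional κ (V lam)] [FiniteDimensional κ M]
    (t : ω.Ext) : LinearMap.trace κ _ (ω.homRep ρ e τ t) =
      (Fintype.card ω.Base : κ)⁻¹ * ∑ w : ω.Base,
        (ω.extRep ρ).character (t * SemidirectProduct.inl w)⁻¹ *
          τ.character (ω.extHom e (t * SemidirectProduct.inl w)) := by
  have : FiniteDimensional κ (ω.VSpace κ V) :=
    Module.Finite.of_basis (Basis.piTensorProduct fun b => Module.finBasis κ (V (ω.part b.1)))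
  rw [trace_eq_average (Representation.linHom (ω.extRep ρ) (τ.comp (ω.extHom e)))
    SemidirectProduct.inl (ω.restrictHom ρ e τ) (ω.restrictHom_injective ρ e τ)
    (ω.exists_restrictHom_eq_iff ρ e τ) t _ (ω.restrictHom_homRep ρ e τ t)]
  congr 1
  refine Finset.sum_congr rfl fun w _ => ?_
  exact Representation.char_linHom _ _ _

end Frobenius

/-! ### The element `v` -/

section Circ

variable (ω : PType) {n : ℕ} (e : ω.Point ≃ Fin n)

theorem extHom_inl_mul_inr_circ (w : ω.Base) :
    ω.extHom e (SemidirectProduct.inl w * SemidirectProduct.inr ω.circ) =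
      e.permCongr (ω.circPerm w) := by
  rw [map_mul, extHom_inl, extHom, SemidirectProduct.lift_inr]
  exact (map_mul e.permCongrHom _ _).symm

/-- The permutation of the blocks is visible on the points because every block has a point, the
partitions being nonempty. -/
theorem extHom_injective : Function.Injective (ω.extHom e) := by
  rw [injective_iff_map_eq_one]
  intro g hg
  have h1 : Equiv.Perm.sigmaCongrRightHom (fun b : ω.Block => Fin (ω.part b.1).card) g.left *
      ω.topPointHom g.right = 1 := by
    apply e.permCongrHom.injective
    rw [map_one, ← hg, ← SemidirectProduct.inl_left_mul_inr_right g, map_mul, map_mul, extHom_inl,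
      extHom, SemidirectProduct.lift_inr]
    simp [baseHom]
  have h2 : g.right = 1 := by
    funext i
    refine Equiv.ext fun k => ?_
    have hpos : 0 < (ω.part i).card := by
      refine Nat.pos_of_ne_zero fun h => ω.part_ne i (YoungDiagram.ext ?_)
      rw [YoungDiagram.cells_bot]
      exact Finset.card_eq_zero.1 h
    have h := congrArg Sigma.fst (DFunLike.congr_fun h1 ⟨⟨i, k⟩, ⟨0, hpos⟩⟩)
    exact eq_of_heq (Sigma.mk.inj h).2
  rw [h2, map_one, mul_one] at h1
  refine SemidirectProduct.ext (Equiv.Perm.sigmaCongrRightHom_injective ?_) h2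
  rw [h1, SemidirectProduct.one_left, map_one]

/-- Equality in `W` is a statement inside `S_n`; injectivity of `extHom` lifts it to the semidirect
product, so any lift of `v` differs from the standard one by an element of `S`. -/
theorem exists_eq_of_mk_eq_v {κ : Type*} [Field κ] {V : YoungDiagram → Type*}
    [∀ lam, AddCommGroup (V lam)] [∀ lam, Module κ (V lam)]
    {ρ : ∀ lam : YoungDiagram, Representation κ (Equiv.Perm (Fin lam.card)) (V lam)} {t : ω.Ext}
    (h : (QuotientGroup.mk (ω.extToN ρ e t) : stabW (ω.subgroupS e) (ω.repS ρ e)) = ω.v ρ e) :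
    ∃ w : ω.Base, t = SemidirectProduct.inr ω.circ * SemidirectProduct.inl w := by
  have h1 := QuotientGroup.eq.1 h.symm
  rw [← map_inv, ← map_mul, Subgroup.mem_subgroupOf, Subgroup.mem_subgroupOf] at h1
  obtain ⟨w, hw⟩ := h1
  refine ⟨w, ?_⟩
  rw [← inv_mul_eq_iff_eq_mul]
  apply ω.extHom_injective e
  rw [extHom_inl, hw]
  rfl

theorem chi_permCongr {X Y : Type*} [Fintype X] [Fintype Y] (mu : YoungDiagram) (e : X ≃ Y)
    (g : Equiv.Perm X) : chi mu (e.permCongr g) = chi mu g := by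
  rw [chi_eq_schurCoord, fixSeries_permCongr, ← chi_eq_schurCoord]

end Circ

end PType

end TwistedLR
end

/-! ### Comparison of the two sums over `S` -/

theorem mainTheorem12 {κ : Type*} [Field κ] [CharZero κ]
    (V : YoungDiagram → Type*) [∀ lam, AddCommGroup (V lam)] [∀ lam, Module κ (V lam)]
    [∀ lam, FiniteDimensional κ (V lam)]
    (ρ : ∀ lam : YoungDiagram, Representation κ (Equiv.Perm (Fin lam.card)) (V lam))
    (hirr : ∀ lam, (ρ lam).IsIrreducible)
    (hchar : ∀ lam g, (ρ lam).character g = (TwistedLR.chi lam g : κ))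
    (ω : TwistedLR.PType) :
    ∃ c : YoungDiagram →₀ ℤ,
      (ω.IsTwistedLR c ∧ ∀ c' : YoungDiagram →₀ ℤ, ω.IsTwistedLR c' → c' = c) ∧
      ∀ (mu : YoungDiagram) (e : ω.Point ≃ Fin mu.card) (t : ω.Ext),
        (QuotientGroup.mk (ω.extToN ρ e t) :
            TwistedLR.stabW (ω.subgroupS e) (ω.repS ρ e)) = ω.v ρ e →
          LinearMap.trace κ
              (Representation.IntertwiningMap (ω.indRep ρ e) (ρ mu))
              (ω.homRep ρ e (ρ mu) t) = (c mu : κ) := by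
  refine ⟨ω.twistedLR, ⟨ω.isTwistedLR_twistedLR, fun c' h => h.eq_twistedLR⟩, fun mu e t ht => ?_⟩
  obtain ⟨w₀, rfl⟩ := ω.exists_eq_of_mk_eq_v e ht
  have hN : (Fintype.card ω.Base : κ) ≠ 0 := by exact_mod_cast Fintype.card_ne_zero
  rw [TwistedLR.PType.trace_homRep, inv_mul_eq_iff_eq_mul₀ hN]
  have h := congrArg (Int.cast : ℤ → κ) (ω.card_base_mul_twistedLR mu)
  push_cast at h
  rw [h]
  -- The trace formula runs over the coset `v S`, the character formula over `S v`. Moving `v` past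
  -- `w₀ w` conjugates it by `circ`, and this gives a bijection of `S`.
  refine Fintype.sum_equiv ((Equiv.mulLeft w₀).trans (ω.topAut ω.circ).toEquiv) _ _ fun w => ?_
  have hw : (SemidirectProduct.inr ω.circ * SemidirectProduct.inl w₀ * SemidirectProduct.inl w :
      ω.Ext) = SemidirectProduct.inl (ω.topAut ω.circ (w₀ * w)) * SemidirectProduct.inr ω.circ := by
    rw [mul_assoc, ← map_mul]
    ext1 <;> simp
  rw [hw, ω.extHom_inl_mul_inr_circ, hchar, TwistedLR.PType.chi_permCongr]
  congr 1
  -- The dual of `V_ω` produces inverses of the cycle products; they disappear because `χ(g⁻¹) =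
  -- χ(g)`.
  refine (ω.trace_extRep_inv ρ _).trans (Finset.prod_congr rfl fun i _ => ?_)
  rw [hchar, TwistedLR.chi_inv]
  rfl
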